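/- Let $k\le n\le m$ be natural numbers, let $M\in\mathbb{R}^{m\times n}$, let $J$ be a permutation of $\{1,\dots,n\}$, and write $M_n=M[:,J]$ for $M$ with its columns permuted by $J$ and $M_k$ for the first $k$ columns of $M_n$. Let $\widehat R\in\mathbb{R}^{p\times n}$, $p\ge k$, be upper-triangular (the computed R-factor of a column-pivoted QR decomposition, with pivots $J$, of a sketch of $M$), let $\widehat R_k$ be its first $k$ rows and $\widehat A_k$ its leading $k\times k$ block. Suppose the following steps are carried out in floating-point arithmetic with unit roundoff $\tilde u\ge 0$: 1. $M^{\mathrm{pre}}_k = M_k\widehat A_k^{-1}$, by triangular substitution; 2. $[Q_k,R^{\mathrm{pre}}_k]=\mathtt{cholqr}(M^{\mathrm{pre}}_k)$, that is, form the Gram matrix $G=(M^{\mathrm{pre}}_k)^*M^{\mathrm{pre}}_k$, compute its upper-triangular Cholesky factor $R^{\mathrm{pre}}_k$ (with $G=(R^{\mathrm{pre}}_k)^*R^{\mathrm{pre}}_k$ in exact arithmetic), and form $Q_k=M^{\mathrm{pre}}_k(R^{\mathrm{pre}}_k)^{-1}$ by triangular substitution; 3. $R_k=R^{\mathrm{pre}}_k\widehat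 R_k$. Here arithmetic with unit roundoff $\tilde u$ is the standard model: each operation $+,-,\times,/,\sqrt{\cdot}$ returns a number within relative error $\tilde u$ of the exact result for its (computed) operands, without underflow or overflow; sums may be evaluated in any order, and the result of a division by zero or of the square root of a negative number is unspecified. From now on $M^{\mathrm{pre}}_k,Q_k,R^{\mathrm{pre}}_k,R_k$ denote the computed matrices. Let $\operatorname{cond}(X)=\sigma_{\max}(X)/\sigma_{\min}(X)$, with value $+\infty$ if $\sigma_{\min}(X)=0$ or if $X$ has no columns. If $$\tilde u\le 0.00022\,m^{-1}n^{-1},\qquad \|M_n-M^{\mathrm{pre}}_k\widehat R_k\|_2\le 0.01\,\|M\|_2,\qquad \operatorname{cond}(M^{\mathrm{pre}}_k)\le 6,$$ then $$\|M_n-Q_kR_k\|_F\le\|M_n-M^{\mathrm{pre}}_k\widehat R_k\|_F+60\,n^2\tilde u\,\|M\|_2 \qquad\text{and}\qquad \|Q_k^*Q_k-I\|_2\le 180\,m\,n\,\tilde u .$$ -/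

import Mathlib

/-! ### Norms and condition number -/

open scoped Matrix.Norms.L2Operator in
/-- The spectral norm of a real matrix (operator norm for the Euclidean norms). -/
noncomputable def norm2 {a b : ℕ} (X : Matrix (Fin a) (Fin b) ℝ) : ℝ := ‖X‖

/-- The Frobenius norm of a real matrix. -/
noncomputable def normF {a b : ℕ} (X : Matrix (Fin a) (Fin b) ℝ) : ℝ :=
  Real.sqrt (∑ i, ∑ j, X i j ^ 2)

/-- The smallest singular value of a matrix with at least one column and at least as many rows as
columns: the minimum of `‖X v‖` over the Euclidean unit vectors `v`. -/
noncomputable def sigmaMin {a b : ℕ} (X : Matrix (Fin a) (Fin b) ℝ) : ℝ :=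
  ⨅ v : {v : EuclideanSpace ℝ (Fin b) // ‖v‖ = 1}, ‖Matrix.toEuclideanLin X v.1‖

open Classical in
/-- The spectral condition number `σ_max / σ_min` of a tall matrix, equal to `∞` when the columns
are linearly dependent. -/
noncomputable def condNumber {a b : ℕ} (X : Matrix (Fin a) (Fin b) ℝ) : ENNReal :=
  if sigmaMin X = 0 then ⊤ else ENNReal.ofReal (norm2 X / sigmaMin X)

/-! ### Arithmetic with unit roundoff `u`

The standard model of floating-point arithmetic: every elementary operation `+, -, *, /, √` returns
a number within relative error `u` of the exact result. The predicates below say that a number or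
matrix is a possible outcome of a computation in this model. The result of an invalid operation
(division by zero, square root of a negative number) is left arbitrary. -/

/-- `y` is a possible result of an elementary operation whose exact result is `x`. -/
def Rounded (u x y : ℝ) : Prop := |y - x| ≤ u * |x|

/-- `c` is a possible computed value of `a / b`. -/
def ComputedDiv (u a b c : ℝ) : Prop := b ≠ 0 → Rounded u (a / b) c

/-- `c` is a possible computed value of `√a`. -/
def ComputedSqrt (u a c : ℝ) : Prop := 0 ≤ a → Rounded u (Real.sqrt a) c

/-- `ComputedSum u f s c`: the number `c` is a possible computed value of `∑ i ∈ s, f i`, the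
additions being performed in any order (and with any bracketing). -/
inductive ComputedSum {ι : Type} (u : ℝ) (f : ι → ℝ) : Finset ι → ℝ → Prop
  | empty : ComputedSum u f ∅ 0
  | single (i : ι) : ComputedSum u f {i} (f i)
  | add {s t : Finset ι} {a b c : ℝ} (hs : s.Nonempty) (ht : t.Nonempty) (hst : Disjoint s t)
      (ha : ComputedSum u f s a) (hb : ComputedSum u f t b) (hc : Rounded u (a + b) c) :
      ComputedSum u f (s.disjUnion t hst) c

/-- `c` is a possible computed value of `∑ l ∈ s, x l * y l`. -/
def ComputedDot {ι : Type} (u : ℝ) (x y : ι → ℝ) (s : Finset ι) (c : ℝ) : Prop :=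
  ∃ p : ι → ℝ, (∀ l ∈ s, Rounded u (x l * y l) (p l)) ∧ ComputedSum u p s c

/-- `c` is a possible computed value of `a - ∑ l ∈ s, x l * y l`, evaluated in any order. -/
def ComputedResidual {ι : Type} (u a : ℝ) (x y : ι → ℝ) (s : Finset ι) (c : ℝ) : Prop :=
  ∃ p : ι → ℝ, (∀ l ∈ s, Rounded u (x l * y l) (p l)) ∧
    ComputedSum u (fun o : Option ι => o.elim a (fun l => - p l)) (Finset.insertNone s) c

/-- `C` is a possible computed value of the matrix product `A * B`. -/
def ComputedMul {a b c : ℕ} (u : ℝ) (A : Matrix (Fin a) (Fin b) ℝ) (B : Matrix (Fin b) (Fin c) ℝ)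
    (C : Matrix (Fin a) (Fin c) ℝ) : Prop :=
  ∀ i j, ComputedDot u (fun l => A i l) (fun l => B l j) Finset.univ (C i j)

/-- `X` is a possible computed value of `B * R⁻¹`, for an upper-triangular `R`, obtained by
substitution in `X * R = B`: `X i j = (B i j - ∑ l < j, X i l * R l j) / R j j`. -/
def ComputedTriSolve {a b : ℕ} (u : ℝ) (B : Matrix (Fin a) (Fin b) ℝ)
    (R : Matrix (Fin b) (Fin b) ℝ) (X : Matrix (Fin a) (Fin b) ℝ) : Prop :=
  ∀ i j, ∃ s, ComputedResidual u (B i j) (fun l => X i l) (fun l => R l j) (Finset.Iio j) s ∧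
    ComputedDiv u s (R j j) (X i j)

/-- `R` is a possible computed upper-triangular Cholesky factor of `G` (so `Rᵀ * R = G` in exact
arithmetic); only the upper triangle of `G` is read. -/
def ComputedCholesky {b : ℕ} (u : ℝ) (G R : Matrix (Fin b) (Fin b) ℝ) : Prop :=
  (∀ i j, j < i → R i j = 0) ∧
  (∀ i j, i < j → ∃ s,
    ComputedResidual u (G i j) (fun l => R l i) (fun l => R l j) (Finset.Iio i) s ∧
    ComputedDiv u s (R i i) (R i j)) ∧
  (∀ j, ∃ s,
    ComputedResidual u (G j j) (fun l => R l j) (fun l => R l j) (Finset.Iio j) s ∧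
    ComputedSqrt u s (R j j))

/-- `Q, R` are possible computed factors of the CholeskyQR decomposition of `X`: form the Gram
matrix `Xᵀ * X`, take its Cholesky factor `R`, and form `Q = X * R⁻¹`. -/
def ComputedCholQR {a b : ℕ} (u : ℝ) (X Q : Matrix (Fin a) (Fin b) ℝ)
    (R : Matrix (Fin b) (Fin b) ℝ) : Prop :=
  ∃ G, ComputedMul u X.transpose X G ∧ ComputedCholesky u G R ∧ ComputedTriSolve u X R Q

/-! ### Preconditioning, CholeskyQR, and undoing the preconditioning -/

/-- `M_n = M[:, J]`, the matrix `M` with its columns permuted by the pivot vector `J`. -/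
def pivotCols {m n : ℕ} (M : Matrix (Fin m) (Fin n) ℝ) (J : Equiv.Perm (Fin n)) :
    Matrix (Fin m) (Fin n) ℝ := M.submatrix id J

/-- The leading `k` columns of a matrix. -/
def leadingCols {a b k : ℕ} (h : k ≤ b) (X : Matrix (Fin a) (Fin b) ℝ) :
    Matrix (Fin a) (Fin k) ℝ := X.submatrix id (Fin.castLE h)

/-- The leading `k` rows of a matrix. -/
def leadingRows {a b k : ℕ} (h : k ≤ a) (X : Matrix (Fin a) (Fin b) ℝ) :
    Matrix (Fin k) (Fin b) ℝ := X.submatrix (Fin.castLE h) id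

/-- Upper-triangularity of a possibly rectangular matrix. -/
def IsUpperTri {a b : ℕ} (R : Matrix (Fin a) (Fin b) ℝ) : Prop :=
  ∀ (i : Fin a) (j : Fin b), (j : ℕ) < (i : ℕ) → R i j = 0

/-- `Mpre, Q, Rpre, R` are possible results, in arithmetic with unit roundoff `u`, of the steps of
the algorithm that follow the pivoted QR decomposition of the sketch (which supplies the R-factor
`Rsk`, the pivots `J` and the truncation index `k`). -/
structure ComputedPrecondCholQR {m n p k : ℕ} (u : ℝ) (hkp : k ≤ p) (hkn : k ≤ n)
    (M : Matrix (Fin m) (Fin n) ℝ) (J : Equiv.Perm (Fin n)) (Rsk : Matrix (Fin p) (Fin n) ℝ)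
    (Mpre Q : Matrix (Fin m) (Fin k) ℝ) (Rpre : Matrix (Fin k) (Fin k) ℝ)
    (R : Matrix (Fin k) (Fin n) ℝ) : Prop where
  /-- Precondition: `Mpre = M_k * A_k⁻¹`, with `A_k` the leading `k × k` block of `Rsk`. -/
  precondition : ComputedTriSolve u (leadingCols hkn (pivotCols M J))
    (leadingCols hkn (leadingRows hkp Rsk)) Mpre
  /-- Decompose: `[Q, Rpre] = cholqr(Mpre)`. -/
  decompose : ComputedCholQR u Mpre Q Rpre
  /-- Undo the preconditioning: `R = Rpre * Rsk_k`, with `Rsk_k` the leading `k` rows of `Rsk`. -/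
  undo : ComputedMul u Rpre (leadingRows hkp Rsk) R

open scoped Matrix

/-! ### Spectral and Frobenius norms -/

section Norms

variable {a b c : ℕ}

/-! Write X for `Mpre`, σ for its least singular value, S for the leading rows of `Rsk`, and w = n m
u ≤ 0.00022; the condition number gives ‖X‖₂ ≤ 6σ. Two points need care: Cholesky must not break
down on the computed Gram matrix, and the conditioning of S must not enter the bounds.

Rounding errors in the Gram matrix and in its factorization are bounded entrywise by multiples of
α_i α_j, where α_i are the column norms of X. Since Σ α_i² = ‖X‖_F² ≤ 36 k σ², the total
perturbation of XᵀX is O(w) σ², far below its least eigenvalue. Hence every pivot stays positive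
(`pivot_pos`, `ComputedCholesky.pos_and_abs_sub_le`) and RᵀR = XᵀX + E with ‖E‖_F ≤ 108.3 w σ²
(`gram_cholesky_error`). The exact quotient Y = X R⁻¹ satisfies YᵀY − I = −R⁻ᵀ E R⁻¹, of norm at
most 111 w (`norm2_bounds_of_gram_error`), and triangular substitution moves the computed Q at most
6.2 w away from Y (`ComputedCholQR.bounds`). This gives orthogonality.

For the residual, the errors of CholeskyQR and of the last product contribute O(k² u) σ ‖S‖₂. Here σ
‖S‖₂ ≤ ‖X S‖₂ ≤ 1.01 ‖M‖₂, because X S is within 0.01 ‖M‖₂ of the pivoted M; so S disappears. -/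

open scoped Matrix.Norms.L2Operator in
theorem sum_sq_mulVec_le (A : Matrix (Fin a) (Fin b) ℝ) (v : Fin b → ℝ) :
    ∑ i, (A *ᵥ v) i ^ 2 ≤ norm2 A ^ 2 * ∑ j, v j ^ 2 := by
  have h := Matrix.l2_opNorm_mulVec A (WithLp.toLp 2 v)
  have h2 := pow_le_pow_left₀ (norm_nonneg _) h 2
  rw [mul_pow, EuclideanSpace.real_norm_sq_eq, EuclideanSpace.real_norm_sq_eq] at h2
  exact h2

open scoped Matrix.Norms.L2Operator in
theorem norm2_nonneg (A : Matrix (Fin a) (Fin b) ℝ) : 0 ≤ norm2 A := norm_nonneg A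

open scoped Matrix.Norms.L2Operator in
theorem norm2_le_of_sum_sq {A : Matrix (Fin a) (Fin b) ℝ} {t : ℝ} (ht : 0 ≤ t)
    (h : ∀ v : Fin b → ℝ, ∑ i, (A *ᵥ v) i ^ 2 ≤ t ^ 2 * ∑ j, v j ^ 2) : norm2 A ≤ t := by
  unfold norm2
  rw [Matrix.l2_opNorm_def]
  refine ContinuousLinearMap.opNorm_le_bound _ ht fun x => ?_
  refine le_of_sq_le_sq ?_ (by positivity)
  rw [mul_pow, EuclideanSpace.real_norm_sq_eq, EuclideanSpace.real_norm_sq_eq]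
  exact h (WithLp.ofLp x)

open scoped Matrix.Norms.L2Operator in
theorem norm2_add_le (A B : Matrix (Fin a) (Fin b) ℝ) : norm2 (A + B) ≤ norm2 A + norm2 B :=
  norm_add_le A B

open scoped Matrix.Norms.L2Operator in
theorem norm2_neg (A : Matrix (Fin a) (Fin b) ℝ) : norm2 (-A) = norm2 A := norm_neg A

open scoped Matrix.Norms.L2Operator in
theorem norm2_sub_le (A B : Matrix (Fin a) (Fin b) ℝ) : norm2 (A - B) ≤ norm2 A + norm2 B :=
  norm_sub_le A B

open scoped Matrix.Norms.L2Operator in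
theorem norm2_mul_le (A : Matrix (Fin a) (Fin b) ℝ) (B : Matrix (Fin b) (Fin c) ℝ) :
    norm2 (A * B) ≤ norm2 A * norm2 B := Matrix.l2_opNorm_mul A B

open scoped Matrix.Norms.L2Operator in
theorem norm2_transpose (A : Matrix (Fin a) (Fin b) ℝ) : norm2 Aᵀ = norm2 A := by
  have := Matrix.l2_opNorm_conjTranspose A
  rwa [Matrix.conjTranspose_eq_transpose_of_trivial] at this

theorem normF_nonneg (A : Matrix (Fin a) (Fin b) ℝ) : 0 ≤ normF A := Real.sqrt_nonneg _

theorem normF_sq (A : Matrix (Fin a) (Fin b) ℝ) : normF A ^ 2 = ∑ i, ∑ j, A i j ^ 2 :=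
  Real.sq_sqrt (Finset.sum_nonneg fun _ _ => Finset.sum_nonneg fun _ _ => sq_nonneg _)

theorem normF_transpose (A : Matrix (Fin a) (Fin b) ℝ) : normF Aᵀ = normF A := by
  unfold normF
  rw [Finset.sum_comm]
  rfl

attribute [local instance] Matrix.frobeniusNormedAddCommGroup in
theorem normF_add_le (A B : Matrix (Fin a) (Fin b) ℝ) : normF (A + B) ≤ normF A + normF B := by
  have key : ∀ C : Matrix (Fin a) (Fin b) ℝ, normF C = ‖C‖ := fun C => by
    rw [Matrix.frobenius_norm_def, normF, Real.sqrt_eq_rpow]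
    simp
  rw [key, key, key]
  exact norm_add_le A B

theorem normF_neg (A : Matrix (Fin a) (Fin b) ℝ) : normF (-A) = normF A := by
  simp [normF]

theorem normF_sub_le (A B : Matrix (Fin a) (Fin b) ℝ) : normF (A - B) ≤ normF A + normF B := by
  rw [sub_eq_add_neg, ← normF_neg B]
  exact normF_add_le _ _

theorem normF_one : normF (1 : Matrix (Fin a) (Fin a) ℝ) = Real.sqrt a := by
  simp [normF, Matrix.one_apply, Finset.sum_ite_eq]

theorem norm2_le_normF (A : Matrix (Fin a) (Fin b) ℝ) : norm2 A ≤ normF A := by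
  refine norm2_le_of_sum_sq (normF_nonneg A) fun v => ?_
  rw [normF_sq, Finset.sum_mul]
  exact Finset.sum_le_sum fun i _ =>
    Finset.sum_mul_sq_le_sq_mul_sq Finset.univ (fun j => A i j) v

theorem normF_mul_le_left (A : Matrix (Fin a) (Fin b) ℝ) (B : Matrix (Fin b) (Fin c) ℝ) :
    normF (A * B) ≤ norm2 A * normF B := by
  refine le_of_sq_le_sq ?_ (mul_nonneg (norm2_nonneg A) (normF_nonneg B))
  rw [mul_pow, normF_sq, normF_sq, Finset.sum_comm, Finset.sum_comm (f := fun i j => B i j ^ 2),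
    Finset.mul_sum]
  exact Finset.sum_le_sum fun j _ => sum_sq_mulVec_le A fun l => B l j

theorem normF_mul_le_right (A : Matrix (Fin a) (Fin b) ℝ) (B : Matrix (Fin b) (Fin c) ℝ) :
    normF (A * B) ≤ normF A * norm2 B := by
  rw [← normF_transpose, Matrix.transpose_mul, mul_comm, ← normF_transpose A, ← norm2_transpose B]
  exact normF_mul_le_left _ _

theorem normF_le_sqrt_mul_norm2 (A : Matrix (Fin a) (Fin b) ℝ) :
    normF A ≤ Real.sqrt b * norm2 A := by
  have := normF_mul_le_left A (1 : Matrix (Fin b) (Fin b) ℝ)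
  rwa [Matrix.mul_one, normF_one, mul_comm] at this

theorem normF_le_sqrt_mul_norm2' (A : Matrix (Fin a) (Fin b) ℝ) :
    normF A ≤ Real.sqrt a * norm2 A := by
  have := normF_mul_le_right (1 : Matrix (Fin a) (Fin a) ℝ) A
  rwa [Matrix.one_mul, normF_one] at this

/-- An entrywise bound by the product of absolute values gives a Frobenius norm bound. -/
theorem normF_le_of_abs_le {A : Matrix (Fin a) (Fin c) ℝ} {B : Matrix (Fin a) (Fin b) ℝ}
    {C : Matrix (Fin b) (Fin c) ℝ} {t : ℝ} (ht : 0 ≤ t)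
    (h : ∀ i j, |A i j| ≤ t * ∑ l, |B i l| * |C l j|) :
    normF A ≤ t * (normF B * normF C) := by
  refine le_of_sq_le_sq ?_
    (mul_nonneg ht (mul_nonneg (normF_nonneg B) (normF_nonneg C)))
  rw [mul_pow, mul_pow, normF_sq, normF_sq, normF_sq, Finset.sum_comm (f := fun i j => C i j ^ 2),
    Finset.sum_mul_sum, Finset.mul_sum]
  refine Finset.sum_le_sum fun i _ => ?_
  rw [Finset.mul_sum]
  refine Finset.sum_le_sum fun j _ => ?_
  calc A i j ^ 2 = |A i j| ^ 2 := (sq_abs _).symm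
    _ ≤ (t * ∑ l, |B i l| * |C l j|) ^ 2 := pow_le_pow_left₀ (abs_nonneg _) (h i j) 2
    _ ≤ t ^ 2 * ((∑ l, B i l ^ 2) * ∑ l, C l j ^ 2) := by
        rw [mul_pow]
        refine mul_le_mul_of_nonneg_left ?_ (sq_nonneg t)
        simpa using Finset.sum_mul_sq_le_sq_mul_sq Finset.univ (fun l => |B i l|) (fun l => |C l j|)

/-- An entrywise bound by a product of vectors gives a Frobenius norm bound. -/
theorem normF_le_of_abs_le_mul {A : Matrix (Fin a) (Fin b) ℝ} {x : Fin a → ℝ} {y : Fin b → ℝ}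
    {t : ℝ} (ht : 0 ≤ t) (h : ∀ i j, |A i j| ≤ t * (|x i| * |y j|)) :
    normF A ≤ t * (Real.sqrt (∑ i, x i ^ 2) * Real.sqrt (∑ j, y j ^ 2)) := by
  have := normF_le_of_abs_le (A := A) (B := Matrix.of fun i (_ : Fin 1) => x i)
    (C := Matrix.of fun (_ : Fin 1) j => y j) ht (by simpa using h)
  simpa [normF] using this

theorem sigmaMin_nonneg (X : Matrix (Fin a) (Fin b) ℝ) : 0 ≤ sigmaMin X :=
  Real.iInf_nonneg fun _ => norm_nonneg _

theorem sigmaMin_sq_mul_le (X : Matrix (Fin a) (Fin b) ℝ) (v : Fin b → ℝ) :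
    sigmaMin X ^ 2 * ∑ j, v j ^ 2 ≤ ∑ i, (X *ᵥ v) i ^ 2 := by
  set w : EuclideanSpace ℝ (Fin b) := WithLp.toLp 2 v with hw
  have key : sigmaMin X * ‖w‖ ≤ ‖Matrix.toEuclideanLin X w‖ := by
    rcases eq_or_ne w 0 with h0 | h0
    · simp [h0]
    have hn : 0 < ‖w‖ := norm_pos_iff.2 h0
    have h1 : sigmaMin X ≤ ‖Matrix.toEuclideanLin X (‖w‖⁻¹ • w)‖ :=
      ciInf_le (f := fun v : {v : EuclideanSpace ℝ (Fin b) // ‖v‖ = 1} =>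
        ‖Matrix.toEuclideanLin X v.1‖) ⟨0, by rintro _ ⟨y, rfl⟩; exact norm_nonneg _⟩
        ⟨‖w‖⁻¹ • w, by rw [norm_smul, norm_inv, norm_norm, inv_mul_cancel₀ hn.ne']⟩
    rw [map_smul, norm_smul, norm_inv, norm_norm] at h1
    calc sigmaMin X * ‖w‖ ≤ ‖w‖⁻¹ * ‖Matrix.toEuclideanLin X w‖ * ‖w‖ := by gcongr
      _ = _ := by field_simp
  have h2 := pow_le_pow_left₀ (mul_nonneg (sigmaMin_nonneg X) (norm_nonneg w)) key 2
  rw [mul_pow, EuclideanSpace.real_norm_sq_eq, EuclideanSpace.real_norm_sq_eq] at h2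
  exact h2

/-- The unit sphere is empty here and the real infimum takes its default value 0. Thus a matrix
without columns has infinite condition number, and a finite bound forces `1 ≤ k`. -/
theorem sigmaMin_of_isEmpty (X : Matrix (Fin a) (Fin 0) ℝ) : sigmaMin X = 0 := by
  have : IsEmpty {v : EuclideanSpace ℝ (Fin 0) // ‖v‖ = 1} :=
    ⟨fun v => by simpa [Subsingleton.elim v.1 0] using v.2⟩
  exact Real.iInf_of_isEmpty _

theorem sigmaMin_pos_of_condNumber_le {X : Matrix (Fin a) (Fin b) ℝ} {t : NNReal}
    (h : condNumber X ≤ t) : 0 < sigmaMin X := by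
  refine lt_of_le_of_ne (sigmaMin_nonneg X) fun h0 => ?_
  simp [condNumber, ← h0] at h

theorem norm2_le_of_condNumber_le {X : Matrix (Fin a) (Fin b) ℝ} {t : NNReal}
    (h : condNumber X ≤ t) : norm2 X ≤ t * sigmaMin X := by
  have h0 := sigmaMin_pos_of_condNumber_le h
  rw [condNumber, if_neg h0.ne', ← ENNReal.ofReal_coe_nnreal, ENNReal.ofReal_le_ofReal_iff t.coe_nonneg,
    div_le_iff₀ h0] at h
  exact h

theorem norm2_pivotCols (M : Matrix (Fin a) (Fin b) ℝ) (J : Equiv.Perm (Fin b)) :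
    norm2 (pivotCols M J) ≤ norm2 M := by
  refine norm2_le_of_sum_sq (norm2_nonneg M) fun v => ?_
  have h := sum_sq_mulVec_le M (v ∘ J.symm)
  have e : (pivotCols M J) *ᵥ v = M *ᵥ (v ∘ J.symm) := Matrix.submatrix_mulVec_equiv M v id J
  rw [e]
  refine h.trans_eq ?_
  rw [← Equiv.sum_comp J.symm fun j => v j ^ 2]
  rfl

end Norms

/-! ### Rounding errors

The errors are expressed through powers of `q = (1 - u)⁻¹`. -/

section Rounding

variable {ι : Type} {u q : ℝ}

theorem one_le_inv_one_sub (hu0 : 0 ≤ u) (hu1 : u < 1) : 1 ≤ (1 - u)⁻¹ :=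
  (one_le_inv₀ (by linarith)).2 (by linarith)

/-- With q = (1 - u)⁻¹ one has u ≤ u q = q - 1. The constant q - 1 bounds the error relative to the
exact value and, in `Rounded.abs_sub_le'`, relative to the computed one; this symmetry is the reason
for measuring errors in powers of q. -/
theorem Rounded.abs_sub_le {x y : ℝ} (h : Rounded u x y) (hu0 : 0 ≤ u) (hu1 : u < 1) :
    |y - x| ≤ ((1 - u)⁻¹ - 1) * |x| := by
  refine h.trans (mul_le_mul_of_nonneg_right ?_ (abs_nonneg x))
  have h1 : (1 - u) * (1 - u)⁻¹ = 1 := mul_inv_cancel₀ (by linarith)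
  nlinarith [mul_le_mul_of_nonneg_left (one_le_inv_one_sub hu0 hu1) hu0]

theorem Rounded.abs_le {x y : ℝ} (h : Rounded u x y) (hu0 : 0 ≤ u) (hu1 : u < 1) :
    |y| ≤ (1 - u)⁻¹ * |x| := by
  have := h.abs_sub_le hu0 hu1
  have h2 := abs_sub_abs_le_abs_sub y x
  linarith

theorem Rounded.abs_le' {x y : ℝ} (h : Rounded u x y) (hu1 : u < 1) :
    |x| ≤ (1 - u)⁻¹ * |y| := by
  have h2 := abs_sub_abs_le_abs_sub x y
  rw [abs_sub_comm] at h2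
  rw [inv_mul_eq_div, le_div_iff₀ (by linarith)]
  have : |y - x| ≤ u * |x| := h
  linarith

theorem Rounded.abs_sub_le' {x y : ℝ} (h : Rounded u x y) (hu0 : 0 ≤ u) (hu1 : u < 1) :
    |x - y| ≤ ((1 - u)⁻¹ - 1) * |y| := by
  have h2 : |y - x| ≤ u * |x| := h
  have h1 : (1 - u) * (1 - u)⁻¹ = 1 := mul_inv_cancel₀ (by linarith)
  have h3 := mul_le_mul_of_nonneg_left (h.abs_le' hu1) hu0
  rw [abs_sub_comm]
  calc |y - x| ≤ u * ((1 - u)⁻¹ * |y|) := h2.trans h3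
    _ = ((1 - u)⁻¹ - (1 - u) * (1 - u)⁻¹) * |y| := by ring
    _ = _ := by rw [h1]

theorem Finset.Nonempty.exists_card_eq_succ {s : Finset ι} (hs : s.Nonempty) :
    ∃ n, s.card = n + 1 :=
  ⟨s.card - 1, (Nat.sub_add_cancel hs.card_pos).symm⟩

theorem ComputedSum.abs_sub_le (hu0 : 0 ≤ u) (hu1 : u < 1) {f : ι → ℝ} {s : Finset ι} {c : ℝ}
    (h : ComputedSum u f s c) :
    |∑ i ∈ s, f i - c| ≤ ((1 - u)⁻¹ ^ (s.card - 1) - 1) * ∑ i ∈ s, |f i| := by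
  have hq := one_le_inv_one_sub hu0 hu1
  induction h with
  | empty => simp
  | single i => simp
  | @add s t A B c hs ht hst _ _ hc iha ihb =>
    -- The two branches use p and r additions, and joining them costs one more, whatever the
    -- bracketing.
    obtain ⟨p, hp⟩ := hs.exists_card_eq_succ
    obtain ⟨r, hr⟩ := ht.exists_card_eq_succ
    have h1 := hc.abs_sub_le hu0 hu1
    rw [Finset.card_disjUnion, Finset.sum_disjUnion, Finset.sum_disjUnion, hp, hr,
      show p + 1 + (r + 1) - 1 = p + r + 1 by omega]
    rw [hp, Nat.add_sub_cancel] at iha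
    rw [hr, Nat.add_sub_cancel] at ihb
    set q := (1 - u)⁻¹
    have hfs := Finset.abs_sum_le_sum_abs f s
    have hft := Finset.abs_sum_le_sum_abs f t
    set fs := ∑ i ∈ s, f i
    set ft := ∑ i ∈ t, f i
    set as := ∑ i ∈ s, |f i|
    set at' := ∑ i ∈ t, |f i|
    have has : 0 ≤ as := (abs_nonneg _).trans hfs
    have hat : 0 ≤ at' := (abs_nonneg _).trans hft
    have hA : |A| ≤ q ^ p * as := by
      have := abs_sub_abs_le_abs_sub A fs
      rw [abs_sub_comm] at this
      linarith
    have hB : |B| ≤ q ^ r * at' := by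
      have := abs_sub_abs_le_abs_sub B ft
      rw [abs_sub_comm] at this
      linarith
    have hAB := abs_add_le A B
    have e : fs + ft - c = (fs - A) + (ft - B) + (A + B - c) := by ring
    have h2 : (q - 1) * |A + B| ≤ (q - 1) * (q ^ p * as + q ^ r * at') :=
      mul_le_mul_of_nonneg_left (by linarith) (by linarith)
    have h3 : q ^ (p + 1) * as ≤ q ^ (p + r + 1) * as :=
      mul_le_mul_of_nonneg_right (pow_le_pow_right₀ hq (by omega)) has
    have h4 : q ^ (r + 1) * at' ≤ q ^ (p + r + 1) * at' :=
      mul_le_mul_of_nonneg_right (pow_le_pow_right₀ hq (by omega)) hat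
    rw [pow_succ] at h3 h4
    rw [e]
    rw [abs_sub_comm] at h1
    refine (abs_add_three _ _ _).trans ?_
    linarith

theorem ComputedSum.abs_le (hu0 : 0 ≤ u) (hu1 : u < 1) {f : ι → ℝ} {s : Finset ι} {c : ℝ}
    (h : ComputedSum u f s c) :
    |c| ≤ (1 - u)⁻¹ ^ (s.card - 1) * ∑ i ∈ s, |f i| := by
  have h1 := h.abs_sub_le hu0 hu1
  have h2 := abs_sub_abs_le_abs_sub c (∑ i ∈ s, f i)
  have h3 := Finset.abs_sum_le_sum_abs f s
  rw [abs_sub_comm] at h2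
  linarith

/-- One node of the summation tree, A being the branch with the distinguished summand. Its error
involves |A|, which is traded for the result c and the other branch through |A| ≤ |A + B| + |B| ≤ q
|c| + q ^ r * at'. -/
theorem abs_add_sub_le_of_backward {A B c fs ft as at' : ℝ} {p r : ℕ} (hq : 1 ≤ q)
    (has : 0 ≤ as) (hat : 0 ≤ at') (hA : |fs - A| ≤ (q ^ p - 1) * (|A| + as))
    (hB : |ft - B| ≤ (q ^ r - 1) * at') (hB' : |B| ≤ q ^ r * at')
    (h1 : |A + B - c| ≤ (q - 1) * |c|) (h2 : |A + B| ≤ q * |c|) :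
    |fs + ft - c| ≤ (q ^ (p + r + 1) - 1) * (|c| + (as + at')) := by
  have e : fs + ft - c = (fs - A) + (ft - B) + (A + B - c) := by ring
  have h3 : |A| ≤ q * |c| + q ^ r * at' := by
    have := abs_sub_abs_le_abs_sub A (-B)
    rw [abs_neg, sub_neg_eq_add] at this
    linarith
  have h4 := mul_le_mul_of_nonneg_left h3 (sub_nonneg.2 (one_le_pow₀ hq : 1 ≤ q ^ p))
  have h5 : q ^ (p + 1) * |c| ≤ q ^ (p + r + 1) * |c| :=
    mul_le_mul_of_nonneg_right (pow_le_pow_right₀ hq (by omega)) (abs_nonneg c)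
  have h6 : q ^ (p + r) * at' ≤ q ^ (p + r + 1) * at' :=
    mul_le_mul_of_nonneg_right (pow_le_pow_right₀ hq (by omega)) hat
  have h7 : q ^ p * as ≤ q ^ (p + r + 1) * as :=
    mul_le_mul_of_nonneg_right (pow_le_pow_right₀ hq (by omega)) has
  rw [pow_succ] at h5
  rw [pow_add] at h6
  rw [e]
  refine (abs_add_three _ _ _).trans ?_
  linarith

/-- Backward form of the summation error: one distinguished summand does not contribute to the
bound, its place being taken by the computed value. -/
theorem ComputedSum.abs_sub_le_backward [DecidableEq ι] (hu0 : 0 ≤ u) (hu1 : u < 1) {f : ι → ℝ}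
    {s : Finset ι} {c : ℝ} (h : ComputedSum u f s c) {o : ι} (ho : o ∈ s) :
    |∑ i ∈ s, f i - c| ≤
      ((1 - u)⁻¹ ^ (s.card - 1) - 1) * (|c| + ∑ i ∈ s.erase o, |f i|) := by
  have hq := one_le_inv_one_sub hu0 hu1
  induction h with
  | empty => simp at ho
  | single i => simp
  | @add s t A B c hs ht hst hA hB hc iha ihb =>
    obtain ⟨p, hp⟩ := hs.exists_card_eq_succ
    obtain ⟨r, hr⟩ := ht.exists_card_eq_succ
    have h1 := hc.abs_sub_le' hu0 hu1
    have h2 := hc.abs_le' hu1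
    have hA1 := hA.abs_sub_le hu0 hu1
    have hB1 := hB.abs_sub_le hu0 hu1
    have hA2 := hA.abs_le hu0 hu1
    have hB2 := hB.abs_le hu0 hu1
    rw [Finset.card_disjUnion, Finset.sum_disjUnion, hp, hr]
    rw [hp, Nat.add_sub_cancel] at iha hA1 hA2
    rw [hr, Nat.add_sub_cancel] at ihb hB1 hB2
    have nn : ∀ z : Finset ι, 0 ≤ ∑ i ∈ z, |f i| := fun z =>
      Finset.sum_nonneg fun _ _ => abs_nonneg _
    rw [Finset.disjUnion_eq_union] at ho ⊢
    rw [Finset.erase_union_distrib, Finset.sum_union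
      (hst.mono (Finset.erase_subset _ _) (Finset.erase_subset _ _))]
    rcases Finset.mem_union.1 ho with h | h
    · rw [Finset.erase_eq_of_notMem (Finset.disjoint_left.1 hst h),
        show p + 1 + (r + 1) - 1 = p + r + 1 by omega]
      exact abs_add_sub_le_of_backward hq (nn _) (nn _) (iha h) hB1 hB2 h1 h2
    · rw [Finset.erase_eq_of_notMem (Finset.disjoint_right.1 hst h),
        show p + 1 + (r + 1) - 1 = r + p + 1 by omega, add_comm (∑ i ∈ s, f i),
        add_comm (∑ i ∈ s, |f i|)]
      rw [add_comm] at h1 h2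
      exact abs_add_sub_le_of_backward hq (nn _) (nn _) (ihb h) hA1 hA2 h1 h2

theorem ComputedDot.abs_sub_le (hu0 : 0 ≤ u) (hu1 : u < 1) {x y : ι → ℝ} {s : Finset ι} {c : ℝ}
    (h : ComputedDot u x y s c) :
    |∑ l ∈ s, x l * y l - c| ≤ ((1 - u)⁻¹ ^ s.card - 1) * ∑ l ∈ s, |x l| * |y l| := by
  have hq := one_le_inv_one_sub hu0 hu1
  obtain ⟨p, hp, hc⟩ := h
  rcases s.eq_empty_or_nonempty with rfl | hs
  · have := hc.abs_le hu0 hu1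
    simpa using this
  obtain ⟨r, hr⟩ := hs.exists_card_eq_succ
  have h1 := hc.abs_sub_le hu0 hu1
  rw [hr, Nat.add_sub_cancel] at h1
  rw [hr]
  set q := (1 - u)⁻¹
  have h2 : ∑ l ∈ s, |p l| ≤ q * ∑ l ∈ s, |x l| * |y l| := by
    rw [Finset.mul_sum]
    exact Finset.sum_le_sum fun l hl => by
      rw [← abs_mul]; exact (hp l hl).abs_le hu0 hu1
  have h3 : |∑ l ∈ s, x l * y l - ∑ l ∈ s, p l| ≤ (q - 1) * ∑ l ∈ s, |x l| * |y l| := by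
    rw [← Finset.sum_sub_distrib, Finset.mul_sum]
    refine (Finset.abs_sum_le_sum_abs _ _).trans (Finset.sum_le_sum fun l hl => ?_)
    rw [← abs_mul, abs_sub_comm]; exact (hp l hl).abs_sub_le hu0 hu1
  have h4 := mul_le_mul_of_nonneg_left h2 (sub_nonneg.2 (one_le_pow₀ hq : 1 ≤ q ^ r))
  have := abs_add_le (∑ l ∈ s, x l * y l - ∑ l ∈ s, p l) (∑ l ∈ s, p l - c)
  rw [sub_add_sub_cancel] at this
  rw [pow_succ]
  linarith

/-- The minuend a is the distinguished summand of the backward bound, so only c and the products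
appear on the right. Each product carries one extra factor q for its own rounding. -/
theorem ComputedResidual.abs_sub_le (hu0 : 0 ≤ u) (hu1 : u < 1) {a : ℝ} {x y : ι → ℝ}
    {s : Finset ι} {c : ℝ} (h : ComputedResidual u a x y s c) :
    |a - ∑ l ∈ s, x l * y l - c| ≤ ((1 - u)⁻¹ ^ s.card - 1) * |c| +
      ((1 - u)⁻¹ ^ (s.card + 1) - 1) * ∑ l ∈ s, |x l| * |y l| := by
  classical
  have hq := one_le_inv_one_sub hu0 hu1
  obtain ⟨p, hp, hc⟩ := h
  have h1 := hc.abs_sub_le_backward hu0 hu1 (Finset.none_mem_insertNone (s := s))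
  have he : (Finset.insertNone s).erase none = s.map Function.Embedding.some := by
    ext o; cases o <;> simp
  rw [Finset.card_insertNone, Nat.add_sub_cancel, he, Finset.sum_insertNone, Finset.sum_map] at h1
  simp only [Option.elim, Function.Embedding.some_apply, abs_neg, Finset.sum_neg_distrib,
    ← sub_eq_add_neg] at h1
  set q := (1 - u)⁻¹
  have h2 : ∑ l ∈ s, |p l| ≤ q * ∑ l ∈ s, |x l| * |y l| := by
    rw [Finset.mul_sum]
    exact Finset.sum_le_sum fun l hl => by
      rw [← abs_mul]; exact (hp l hl).abs_le hu0 hu1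
  have h3 : |∑ l ∈ s, p l - ∑ l ∈ s, x l * y l| ≤ (q - 1) * ∑ l ∈ s, |x l| * |y l| := by
    rw [← Finset.sum_sub_distrib, Finset.mul_sum]
    refine (Finset.abs_sum_le_sum_abs _ _).trans (Finset.sum_le_sum fun l hl => ?_)
    rw [← abs_mul]; exact (hp l hl).abs_sub_le hu0 hu1
  have h4 := mul_le_mul_of_nonneg_left h2 (sub_nonneg.2 (one_le_pow₀ hq : 1 ≤ q ^ s.card))
  have := abs_add_le (a - ∑ l ∈ s, p l - c) (∑ l ∈ s, p l - ∑ l ∈ s, x l * y l)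
  rw [show a - ∑ l ∈ s, p l - c + (∑ l ∈ s, p l - ∑ l ∈ s, x l * y l) =
    a - ∑ l ∈ s, x l * y l - c by ring] at this
  rw [pow_succ]
  linarith

theorem ComputedResidual.abs_sub_mul_le_of_div (hu0 : 0 ≤ u) (hu1 : u < 1) {a : ℝ} {x y : ι → ℝ}
    {s : Finset ι} {c d r : ℝ} (h : ComputedResidual u a x y s c) (hr : ComputedDiv u c d r)
    (hd : d ≠ 0) :
    |a - ∑ l ∈ s, x l * y l - r * d| ≤
      ((1 - u)⁻¹ ^ (s.card + 1) - 1) * (|r * d| + ∑ l ∈ s, |x l| * |y l|) := by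
  have hq := one_le_inv_one_sub hu0 hu1
  have h1 := h.abs_sub_le hu0 hu1
  have h2 := mul_le_mul_of_nonneg_right ((hr hd).abs_sub_le' hu0 hu1) (abs_nonneg d)
  have h3 := mul_le_mul_of_nonneg_right ((hr hd).abs_le' hu1) (abs_nonneg d)
  rw [mul_assoc, ← abs_mul, ← abs_mul, sub_mul, div_mul_cancel₀ _ hd] at h2
  rw [mul_assoc, ← abs_mul, ← abs_mul, div_mul_cancel₀ _ hd] at h3
  set q := (1 - u)⁻¹
  have h4 := mul_le_mul_of_nonneg_left h3 (sub_nonneg.2 (one_le_pow₀ hq : 1 ≤ q ^ s.card))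
  have := abs_add_le (a - ∑ l ∈ s, x l * y l - c) (c - r * d)
  rw [sub_add_sub_cancel] at this
  rw [pow_succ] at h1 ⊢
  linarith

theorem ComputedSqrt.le_of_nonneg {a r : ℝ} (h : ComputedSqrt u a r) (ha : 0 ≤ a) :
    (1 - u) * Real.sqrt a ≤ r := by
  have h1 : |r - Real.sqrt a| ≤ u * |Real.sqrt a| := h ha
  rw [abs_of_nonneg (Real.sqrt_nonneg a)] at h1
  linarith [(abs_le.1 h1).1]

theorem ComputedSqrt.abs_sub_sq_le (hu0 : 0 ≤ u) (hu1 : u < 1) {a r : ℝ} (h : ComputedSqrt u a r)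
    (ha : 0 ≤ a) : |a - r ^ 2| ≤ ((1 - u)⁻¹ ^ 2 - 1) * r ^ 2 ∧ a ≤ (1 - u)⁻¹ ^ 2 * r ^ 2 := by
  have hq := one_le_inv_one_sub hu0 hu1
  have h1 := pow_le_pow_left₀ (abs_nonneg _) ((h ha).abs_le hu0 hu1) 2
  have h2 := pow_le_pow_left₀ (abs_nonneg _) ((h ha).abs_le' hu1) 2
  rw [mul_pow, sq_abs, sq_abs, Real.sq_sqrt ha] at h1 h2
  refine ⟨?_, h2⟩
  set q := (1 - u)⁻¹
  have hq2 : 1 ≤ q ^ 2 := one_le_pow₀ hq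
  rw [abs_le]
  constructor
  · rcases le_total (r ^ 2) a with h3 | h3
    · nlinarith [mul_nonneg (sub_nonneg.2 hq2) (sq_nonneg r)]
    · nlinarith [mul_nonneg (sub_nonneg.2 hq2) (sub_nonneg.2 h3)]
  · linarith

theorem ComputedResidual.abs_sub_sq_le_of_sqrt (hu0 : 0 ≤ u) (hu1 : u < 1) {a : ℝ} {x y : ι → ℝ}
    {s : Finset ι} {c r : ℝ} (h : ComputedResidual u a x y s c) (hr : ComputedSqrt u c r)
    (hc : 0 ≤ c) :
    |a - ∑ l ∈ s, x l * y l - r ^ 2| ≤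
      ((1 - u)⁻¹ ^ (s.card + 2) - 1) * (r ^ 2 + ∑ l ∈ s, |x l| * |y l|) := by
  have hq := one_le_inv_one_sub hu0 hu1
  have h1 := h.abs_sub_le hu0 hu1
  obtain ⟨h2, h3⟩ := hr.abs_sub_sq_le hu0 hu1 hc
  rw [abs_of_nonneg hc] at h1
  set q := (1 - u)⁻¹
  have h4 := mul_le_mul_of_nonneg_left h3 (sub_nonneg.2 (one_le_pow₀ hq : 1 ≤ q ^ s.card))
  have := abs_add_le (a - ∑ l ∈ s, x l * y l - c) (c - r ^ 2)
  rw [sub_add_sub_cancel] at this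
  have h5 : q ^ (s.card + 1) * ∑ l ∈ s, |x l| * |y l| ≤
      q ^ (s.card + 2) * ∑ l ∈ s, |x l| * |y l| :=
    mul_le_mul_of_nonneg_right (pow_le_pow_right₀ hq (by omega))
      (Finset.sum_nonneg fun _ _ => by positivity)
  rw [pow_add q _ 2] at h5 ⊢
  linarith

/-- If the computed residual is not positive, the exact one is at most of the order of the
rounding errors. -/
theorem ComputedResidual.sub_le_of_nonpos (hu0 : 0 ≤ u) (hu1 : u < 1) {a : ℝ} {x y : ι → ℝ}
    {s : Finset ι} {c : ℝ} (h : ComputedResidual u a x y s c) (hc : c ≤ 0)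
    (hs : (1 - u)⁻¹ ^ s.card ≤ 2) :
    a - ∑ l ∈ s, x l * y l ≤ ((1 - u)⁻¹ ^ (s.card + 1) - 1) * ∑ l ∈ s, |x l| * |y l| := by
  have h1 := (abs_le.1 (h.abs_sub_le hu0 hu1)).2
  rw [abs_of_nonpos hc] at h1
  -- The terms in c combine to c (2 - q ^ s.card), which is nonpositive and can be dropped.
  nlinarith

/-- By Bernoulli (1 - u) ^ n ≥ 1 - n u, and 1 / (1 - x) ≤ 1 + 1.001 x for 0 ≤ x ≤ 0.0009. -/
theorem inv_one_sub_pow_sub_one_le (hu0 : 0 ≤ u) {n : ℕ} (h : n * u ≤ 0.0009) :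
    (1 - u)⁻¹ ^ n - 1 ≤ 1.001 * (n * u) := by
  rcases n.eq_zero_or_pos with rfl | hn
  · simp
  have hn' : (1 : ℝ) ≤ n := by exact_mod_cast hn
  have hu : u ≤ 0.0009 := by nlinarith
  have h1 := one_add_mul_le_pow (a := -u) (by linarith) n
  rw [← sub_eq_add_neg] at h1
  have h2 : 0 ≤ n * u := by positivity
  have h3 : 0 < (1 - u) ^ n := pow_pos (by linarith) n
  rw [inv_pow, sub_le_iff_le_add, inv_le_iff_one_le_mul₀ h3]
  nlinarith

end Rounding

/-! ### Cholesky factorization -/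

section Cholesky

variable {k : ℕ} {u : ℝ} {G R : Matrix (Fin k) (Fin k) ℝ}

theorem Finset.sum_Iic_eq_sum_Iio_add (i : Fin k) (f : Fin k → ℝ) :
    ∑ l ∈ Finset.Iic i, f l = ∑ l ∈ Finset.Iio i, f l + f i := by
  rw [← Finset.Iio_insert, Finset.sum_insert (by simp), add_comm]

theorem ComputedCholesky.abs_sub_le_of_lt (hu0 : 0 ≤ u) (hu1 : u < 1)
    (h : ComputedCholesky u G R) {i j : Fin k} (hij : i < j) (hi : R i i ≠ 0) :
    |G i j - ∑ l ∈ Finset.Iic i, R l i * R l j| ≤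
      ((1 - u)⁻¹ ^ (k + 1) - 1) * ∑ l ∈ Finset.Iic i, |R l i| * |R l j| := by
  obtain ⟨s, hs, hd⟩ := h.2.1 i j hij
  have h1 := hs.abs_sub_mul_le_of_div hu0 hu1 hd hi
  rw [Finset.sum_Iic_eq_sum_Iio_add, Finset.sum_Iic_eq_sum_Iio_add, ← sub_sub, ← abs_mul (R i i),
    mul_comm (R i i), add_comm (∑ l ∈ Finset.Iio i, |R l i| * |R l j|)]
  refine h1.trans (mul_le_mul_of_nonneg_right ?_ ?_)
  · refine sub_le_sub_right (pow_le_pow_right₀ (one_le_inv_one_sub hu0 hu1) ?_) 1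
    rw [Fin.card_Iio]; omega
  · exact add_nonneg (abs_nonneg _) (Finset.sum_nonneg fun _ _ => by positivity)

theorem abs_sub_sum_Iic_le_of_sqrt (hu0 : 0 ≤ u) (hu1 : u < 1) {j : Fin k} {s : ℝ}
    (hs : ComputedResidual u (G j j) (fun l => R l j) (fun l => R l j) (Finset.Iio j) s)
    (hd : ComputedSqrt u s (R j j)) (h0 : 0 ≤ s) :
    |G j j - ∑ l ∈ Finset.Iic j, R l j * R l j| ≤
      ((1 - u)⁻¹ ^ (k + 1) - 1) * ∑ l ∈ Finset.Iic j, |R l j| * |R l j| := by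
  have h1 := hs.abs_sub_sq_le_of_sqrt hu0 hu1 hd h0
  rw [Finset.sum_Iic_eq_sum_Iio_add, Finset.sum_Iic_eq_sum_Iio_add, ← sub_sub,
    abs_mul_abs_self (R j j), ← sq, add_comm (∑ l ∈ Finset.Iio j, |R l j| * |R l j|)]
  refine h1.trans (mul_le_mul_of_nonneg_right ?_ ?_)
  -- The square root costs two factors q beyond `(Finset.Iio j).card`, which is at most k - 1; hence
  -- the exponent k + 1.
  · refine sub_le_sub_right (pow_le_pow_right₀ (one_le_inv_one_sub hu0 hu1) ?_) 1
    rw [Fin.card_Iio]; omega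
  · exact add_nonneg (sq_nonneg _) (Finset.sum_nonneg fun _ _ => by positivity)

theorem sum_abs_mul_abs_le_sqrt {ι : Type*} (s : Finset ι) (x y : ι → ℝ) :
    ∑ l ∈ s, |x l| * |y l| ≤ Real.sqrt (∑ l ∈ s, x l ^ 2) * Real.sqrt (∑ l ∈ s, y l ^ 2) := by
  simpa using Real.sum_mul_le_sqrt_mul_sqrt s (fun l => |x l|) fun l => |y l|

/-- Rows beyond the first `j` do not matter for a nonzero kernel vector supported on `0, …, j`. -/
theorem exists_kernel_vector (R : Matrix (Fin k) (Fin k) ℝ) (j : Fin k) :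
    ∃ v : Fin k → ℝ, v ≠ 0 ∧ (∀ l, j < l → v l = 0) ∧ ∀ l < j, ∑ i, R l i * v i = 0 := by
  classical
  -- Rows of R above j, a zero row at j making S singular, and identity rows below j forcing the
  -- kernel vector to vanish there.
  set S : Matrix (Fin k) (Fin k) ℝ := Matrix.of fun l i =>
    if l < j then R l i else if l = j then 0 else if l = i then 1 else 0 with hS
  have hdet : S.det = 0 := Matrix.det_eq_zero_of_row_eq_zero j fun i => by simp [hS]
  obtain ⟨v, hv, hSv⟩ := Matrix.exists_mulVec_eq_zero_iff.2 hdet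
  refine ⟨v, hv, fun l hl => ?_, fun l hl => ?_⟩
  · have := congrFun hSv l
    simpa [hS, Matrix.mulVec, dotProduct, hl.ne', hl.le.not_gt] using this
  · have := congrFun hSv l
    simpa [hS, Matrix.mulVec, dotProduct, hl] using this

theorem sum_sum_mul_mul_eq (s : Finset (Fin k)) (R : Matrix (Fin k) (Fin k) ℝ) (v : Fin k → ℝ) :
    ∑ i, ∑ i', (∑ l ∈ s, R l i * R l i') * (v i * v i') = ∑ l ∈ s, (∑ i, R l i * v i) ^ 2 := by
  simp_rw [sq, Finset.sum_mul_sum, Finset.sum_mul]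
  rw [Finset.sum_comm (s := s)]
  refine Finset.sum_congr rfl fun i _ => ?_
  rw [Finset.sum_comm (s := s)]
  exact Finset.sum_congr rfl fun i' _ => Finset.sum_congr rfl fun l _ => by ring

/-- A computed pivot is positive if the matrix is sufficiently positive definite. -/
theorem pivot_pos {A : Matrix (Fin k) (Fin k) ℝ} {α : Fin k → ℝ} {lam δ ε : ℝ}
    (hα : ∀ i, 0 ≤ α i) (hA : A.IsSymm) (hAα : ∀ i, A i i = α i ^ 2)
    (hlam : ∀ v : Fin k → ℝ, lam * ∑ i, v i ^ 2 ≤ ∑ i, ∑ i', A i i' * (v i * v i'))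
    (hδ0 : 0 ≤ δ) (hδ : δ ≤ 0.0005) (hε0 : 0 ≤ ε) (hε : ε ≤ 0.0005)
    (hsmall : (δ + 2.004 * ε) * ∑ i, α i ^ 2 < lam)
    (hG : ∀ i j, i ≤ j → |A i j - G i j| ≤ δ * (α i * α j))
    {j : Fin k} (htri : ∀ i j, j < i → R i j = 0)
    (hR : ∀ i < j, ∀ i' ≤ j, i ≤ i' → |G i i' - ∑ l ∈ Finset.Iic i, R l i * R l i'| ≤
      ε * ∑ l ∈ Finset.Iic i, |R l i| * |R l i'|) :
    ε * ∑ l ∈ Finset.Iio j, R l j ^ 2 < G j j - ∑ l ∈ Finset.Iio j, R l j ^ 2 := by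
  -- If the pivot is too small, test A against a vector v killed by the first j rows of R. The
  -- partial Gram matrix B of those rows has vᵀBv = 0, so vᵀAv = vᵀ(A - B)v consists of rounding
  -- errors only and is less than lam ‖v‖².
  by_contra! hj
  obtain ⟨v, hv0, hvj, hker⟩ := exists_kernel_vector R j
  set β : Fin k → ℝ := fun i => Real.sqrt (∑ l ∈ Finset.Iio j, R l i ^ 2) with hβ
  have hβ0 : ∀ i, 0 ≤ β i := fun i => Real.sqrt_nonneg _
  have hβsq : ∀ i, β i ^ 2 = ∑ l ∈ Finset.Iio j, R l i ^ 2 := fun i =>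
    Real.sq_sqrt (Finset.sum_nonneg fun _ _ => sq_nonneg _)
  set B : Matrix (Fin k) (Fin k) ℝ := Matrix.of fun i i' => ∑ l ∈ Finset.Iio j, R l i * R l i'
    with hB
  have hsum : ∀ i < j, ∀ f : Fin k → ℝ, (∀ l, i < l → f l = 0) →
      ∑ l ∈ Finset.Iic i, f l = ∑ l ∈ Finset.Iio j, f l := fun i hi f hf =>
    Finset.sum_subset (fun l hl => Finset.mem_Iio.2 ((Finset.mem_Iic.1 hl).trans_lt hi))
      fun l _ hl => hf l (by simpa using hl)
  have hGB : ∀ i < j, ∀ i' ≤ j, i ≤ i' → |G i i' - B i i'| ≤ ε * (β i * β i') := by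
    intro i hi i' hi' hii'
    have h1 := hR i hi i' hi' hii'
    rw [hsum i hi _ fun l hl => by rw [htri l i hl, zero_mul],
      hsum i hi _ fun l hl => by rw [htri l i hl, abs_zero, zero_mul]] at h1
    exact h1.trans (mul_le_mul_of_nonneg_left (sum_abs_mul_abs_le_sqrt _ _ _) hε0)
  have hGle : ∀ i, G i i ≤ (1 + δ) * α i ^ 2 := fun i => by
    have := (abs_le.1 (hG i i le_rfl)).1
    rw [hAα] at this
    linarith
  have hβα : ∀ i < j, β i ^ 2 ≤ 1.002 * α i ^ 2 := fun i hi => by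
    have h1 := (abs_le.1 (hGB i hi i hi.le le_rfl)).1
    have h2 : B i i = β i ^ 2 := by rw [hβsq]; simp [hB, sq]
    rw [h2] at h1
    nlinarith [hGle i, sq_nonneg (α i), sq_nonneg (β i)]
  rw [← hβsq] at hj
  -- The negated claim gives G j j ≤ (1 + ε) β j ^ 2. Multiplying by 1 - 2ε leaves a negative
  -- multiple of β j ^ 2, at the price of 2ε G j j, which α j controls.
  have hGj : G j j - β j ^ 2 ≤ 2 * ε * (1.002 * α j ^ 2) - ε * β j ^ 2 := by
    have h1 : (1 - 2 * ε) * G j j ≤ (1 - 2 * ε) * ((1 + ε) * β j ^ 2) :=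
      mul_le_mul_of_nonneg_left (by linarith) (by linarith)
    have h2 : ε * G j j ≤ ε * (1.002 * α j ^ 2) :=
      mul_le_mul_of_nonneg_left (by nlinarith [hGle j, sq_nonneg (α j)]) hε0
    nlinarith [mul_nonneg (sq_nonneg ε) (sq_nonneg (β j))]
  -- Correction at the entry (j, j). The bound `hβα` covers only i < j, so β j must be absorbed by
  -- the negative term of C.
  set C : ℝ := 2 * ε * (1.002 * α j ^ 2 * v j ^ 2) - 2 * ε * (β j * |v j|) ^ 2 with hC
  have hpt : ∀ i i', (A i i' - B i i') * (v i * v i') ≤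
      δ * ((α i * |v i|) * (α i' * |v i'|)) + ε * ((β i * |v i|) * (β i' * |v i'|)) +
        if i = j then (if i' = j then C else 0) else 0 := by
    have hle : ∀ i i', i ≤ i' → (A i i' - B i i') * (v i * v i') ≤
        δ * ((α i * |v i|) * (α i' * |v i'|)) + ε * ((β i * |v i|) * (β i' * |v i'|)) +
          if i = j then (if i' = j then C else 0) else 0 := by
      intro i i' hii'
      have h1 : (A i i' - G i i') * (v i * v i') ≤ δ * ((α i * |v i|) * (α i' * |v i'|)) := by
        refine (le_abs_self _).trans ?_
        rw [abs_mul, abs_mul (v i)]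
        refine (mul_le_mul_of_nonneg_right (hG i i' hii') (by positivity)).trans_eq (by ring)
      have e : (A i i' - B i i') * (v i * v i') =
        (A i i' - G i i') * (v i * v i') + (G i i' - B i i') * (v i * v i') := by ring
      rw [e, add_assoc]
      refine add_le_add h1 ?_
      rcases lt_or_ge j i' with hji | hji
      · rw [hvj i' hji, if_neg hji.ne']; simp
      rcases hii'.lt_or_eq with hlt | rfl
      · rw [if_neg (hlt.trans_le hji).ne, add_zero]
        refine (le_abs_self _).trans ?_
        rw [abs_mul, abs_mul (v i)]
        exact (mul_le_mul_of_nonneg_right (hGB i (hlt.trans_le hji) i' hji hii')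
          (by positivity)).trans_eq (by ring)
      rcases hji.lt_or_eq with hlt | rfl
      · rw [if_neg hlt.ne, add_zero]
        refine (le_abs_self _).trans ?_
        rw [abs_mul, abs_mul (v i)]
        exact (mul_le_mul_of_nonneg_right (hGB i hlt i hji le_rfl)
          (by positivity)).trans_eq (by ring)
      · rw [if_pos rfl, if_pos rfl]
        have h2 : B i i = β i ^ 2 := by rw [hβsq]; simp [hB, sq]
        rw [h2, hC, mul_pow, sq_abs]
        have := mul_le_mul_of_nonneg_right hGj (sq_nonneg (v i))
        have h3 : (β i * |v i|) * (β i * |v i|) = β i ^ 2 * v i ^ 2 := by rw [← sq_abs (v i)]; ring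
        rw [h3]
        linarith
    intro i i'
    rcases le_total i i' with h | h
    · exact hle i i' h
    · have h1 := hle i' i h
      have hBs : B i' i = B i i' := by simp [hB, mul_comm]
      rw [hBs, hA.apply i i'] at h1
      have e : (if i' = j then (if i = j then C else 0) else 0) =
          if i = j then (if i' = j then C else 0) else 0 := by
        split_ifs <;> rfl
      rw [e] at h1
      linarith
  have hvv : 0 < ∑ i, v i ^ 2 := by
    obtain ⟨i, hi⟩ := Function.ne_iff.1 hv0
    exact Finset.sum_pos' (fun _ _ => sq_nonneg _) ⟨i, Finset.mem_univ _, sq_pos_of_ne_zero hi⟩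
  have hBzero : ∑ i, ∑ i', B i i' * (v i * v i') = 0 := by
    simp only [hB, Matrix.of_apply]
    rw [sum_sum_mul_mul_eq]
    exact Finset.sum_eq_zero fun l hl => by rw [hker l (Finset.mem_Iio.1 hl)]; simp
  have hAeq : ∑ i, ∑ i', A i i' * (v i * v i') = ∑ i, ∑ i', (A i i' - B i i') * (v i * v i') := by
    simp_rw [sub_mul, Finset.sum_sub_distrib]
    rw [hBzero, sub_zero]
  have htot : ∑ i, ∑ i', A i i' * (v i * v i') ≤
      δ * (∑ i, α i * |v i|) ^ 2 + ε * (∑ i, β i * |v i|) ^ 2 + C := by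
    rw [hAeq]
    refine (Finset.sum_le_sum fun i _ => Finset.sum_le_sum fun i' _ => hpt i i').trans_eq ?_
    simp only [Finset.sum_add_distrib, ← Finset.mul_sum, sq, Finset.sum_mul_sum,
      Finset.sum_ite_irrel, Finset.sum_ite_eq', Finset.mem_univ, if_true, Finset.sum_const_zero]
  have hcs1 : (∑ i, α i * |v i|) ^ 2 ≤ (∑ i, α i ^ 2) * ∑ i, v i ^ 2 := by
    simpa using Finset.sum_mul_sq_le_sq_mul_sq Finset.univ α fun i => |v i|
  have hsplit : ∑ i, β i * |v i| = β j * |v j| + ∑ i ∈ Finset.univ.erase j, β i * |v i| :=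
    (Finset.add_sum_erase _ _ (Finset.mem_univ j)).symm
  have hcs2 : (∑ i ∈ Finset.univ.erase j, β i * |v i|) ^ 2 ≤
      1.002 * (∑ i ∈ Finset.univ.erase j, α i ^ 2) * ∑ i, v i ^ 2 := by
    have h1 : ∑ i ∈ Finset.univ.erase j, β i * |v i| ≤
        ∑ i ∈ Finset.univ.erase j, Real.sqrt 1.002 * α i * |v i| := by
      refine Finset.sum_le_sum fun i hi => ?_
      rcases lt_or_gt_of_ne (Finset.ne_of_mem_erase hi) with h | h
      · refine mul_le_mul_of_nonneg_right ?_ (abs_nonneg _)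
        refine le_of_sq_le_sq ?_ (mul_nonneg (Real.sqrt_nonneg _) (hα i))
        rw [mul_pow, Real.sq_sqrt (show (0 : ℝ) ≤ 1.002 by norm_num)]
        exact hβα i h
      · simp [hvj i h]
    have h2 := pow_le_pow_left₀ (Finset.sum_nonneg fun i _ => mul_nonneg (hβ0 i) (abs_nonneg _))
      h1 2
    refine h2.trans ((Finset.sum_mul_sq_le_sq_mul_sq _ _ _).trans ?_)
    simp_rw [mul_pow, Real.sq_sqrt (show (0 : ℝ) ≤ 1.002 by norm_num), sq_abs, ← Finset.mul_sum]
    refine mul_le_mul_of_nonneg_left ?_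
      (mul_nonneg (by norm_num) (Finset.sum_nonneg fun _ _ => sq_nonneg _))
    exact Finset.sum_le_sum_of_subset_of_nonneg (Finset.erase_subset _ _)
      fun _ _ _ => sq_nonneg _
  have hvj2 : v j ^ 2 ≤ ∑ i, v i ^ 2 :=
    Finset.single_le_sum (f := fun i => v i ^ 2) (fun _ _ => sq_nonneg _) (Finset.mem_univ j)
  have hΦ : ∑ i, α i ^ 2 = α j ^ 2 + ∑ i ∈ Finset.univ.erase j, α i ^ 2 :=
    (Finset.add_sum_erase _ _ (Finset.mem_univ j)).symm
  have hfin : ε * (∑ i, β i * |v i|) ^ 2 + C ≤ 2.004 * ε * (∑ i, α i ^ 2) * ∑ i, v i ^ 2 := by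
    rw [hsplit, hC, hΦ]
    set S := ∑ i ∈ Finset.univ.erase j, β i * |v i|
    set t := β j * |v j|
    have h1 := mul_le_mul_of_nonneg_left hvj2 (by positivity : 0 ≤ 1.002 * α j ^ 2)
    -- Here the negative part of C removes β j; the factor 2 on S ^ 2, times 1.002 from `hβα`, gives
    -- 2.004.
    have h2 : (t + S) ^ 2 - 2 * t ^ 2 ≤ 2 * S ^ 2 := by nlinarith [sq_nonneg (t - S)]
    have h3 := mul_le_mul_of_nonneg_left h2 hε0
    have h4 := mul_le_mul_of_nonneg_left hcs2 hε0
    have h5 := mul_le_mul_of_nonneg_left h1 hε0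
    linarith
  have h1 := hlam v
  have h2 := mul_le_mul_of_nonneg_left hcs1 hδ0
  have h3 := mul_lt_mul_of_pos_right hsmall hvv
  linarith

/-- Cholesky factorization of a computed Gram matrix runs to completion, with small backward
error, if the matrix is sufficiently positive definite. -/
theorem ComputedCholesky.pos_and_abs_sub_le (hu0 : 0 ≤ u) (hu1 : u < 1)
    (h : ComputedCholesky u G R) {A : Matrix (Fin k) (Fin k) ℝ} {α : Fin k → ℝ} {lam δ : ℝ}
    (hα : ∀ i, 0 ≤ α i) (hA : A.IsSymm) (hAα : ∀ i, A i i = α i ^ 2)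
    (hlam : ∀ v : Fin k → ℝ, lam * ∑ i, v i ^ 2 ≤ ∑ i, ∑ i', A i i' * (v i * v i'))
    (hδ0 : 0 ≤ δ) (hδ : δ ≤ 0.0005) (hε : (1 - u)⁻¹ ^ (k + 1) - 1 ≤ 0.0005)
    (hsmall : (δ + 2.004 * ((1 - u)⁻¹ ^ (k + 1) - 1)) * ∑ i, α i ^ 2 < lam)
    (hG : ∀ i j, i ≤ j → |A i j - G i j| ≤ δ * (α i * α j)) :
    (∀ j, 0 < R j j) ∧
      ∀ i j, |(Rᵀ * R - A) i j| ≤ (δ + 1.002 * ((1 - u)⁻¹ ^ (k + 1) - 1)) * (α i * α j) := by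
  have hq := one_le_inv_one_sub hu0 hu1
  have hε0 : 0 ≤ (1 - u)⁻¹ ^ (k + 1) - 1 := sub_nonneg.2 (one_le_pow₀ hq)
  set ε := (1 - u)⁻¹ ^ (k + 1) - 1 with hεdef
  have key : ∀ j, 0 < R j j ∧ |G j j - ∑ l ∈ Finset.Iic j, R l j * R l j| ≤
      ε * ∑ l ∈ Finset.Iic j, |R l j| * |R l j| := by
    -- Strong induction: earlier pivots being positive, the earlier rows satisfy the error bounds.
    -- `pivot_pos` then makes the exact residual too large for the computed one to be nonpositive.
    intro j
    induction j using WellFoundedLT.induction with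
    | ind j ih =>
      obtain ⟨s, hs, hd⟩ := h.2.2 j
      have hpos : 0 < s := by
        by_contra! hs0
        have h1 := pivot_pos hα hA hAα hlam hδ0 hδ hε0 hε hsmall hG (j := j) h.1
          fun i hi i' _ hii' => by
            rcases hii'.lt_or_eq with hlt | rfl
            · exact h.abs_sub_le_of_lt hu0 hu1 hlt (ih i hi).1.ne'
            · exact (ih i hi).2
        have hc : (Finset.Iio j).card + 1 ≤ k + 1 := by rw [Fin.card_Iio]; omega
        have h2 := hs.sub_le_of_nonpos hu0 hu1 hs0 (by
          have : (1 - u)⁻¹ ^ (Finset.Iio j).card ≤ (1 - u)⁻¹ ^ (k + 1) :=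
            pow_le_pow_right₀ hq (by omega)
          linarith)
        simp only [← sq, sq_abs] at h2
        have h3 : ((1 - u)⁻¹ ^ ((Finset.Iio j).card + 1) - 1) * ∑ l ∈ Finset.Iio j, R l j ^ 2 ≤
            ε * ∑ l ∈ Finset.Iio j, R l j ^ 2 :=
          mul_le_mul_of_nonneg_right (sub_le_sub_right (pow_le_pow_right₀ hq hc) 1)
            (Finset.sum_nonneg fun _ _ => sq_nonneg _)
        linarith
      refine ⟨?_, abs_sub_sum_Iic_le_of_sqrt hu0 hu1 hs hd hpos.le⟩
      exact (mul_pos (by linarith) (Real.sqrt_pos.2 hpos)).trans_le (hd.le_of_nonneg hpos.le)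
  refine ⟨fun j => (key j).1, ?_⟩
  have hsum : ∀ i, ∀ f : Fin k → ℝ, (∀ l, i < l → f l = 0) →
      ∑ l ∈ Finset.Iic i, f l = ∑ l, f l := fun i f hf =>
    Finset.sum_subset (Finset.subset_univ _) fun l _ hl => hf l (by simpa using hl)
  set β : Fin k → ℝ := fun i => Real.sqrt (∑ l, R l i ^ 2) with hβ
  have hβ0 : ∀ i, 0 ≤ β i := fun i => Real.sqrt_nonneg _
  have hβsq : ∀ i, β i ^ 2 = ∑ l, R l i ^ 2 := fun i =>
    Real.sq_sqrt (Finset.sum_nonneg fun _ _ => sq_nonneg _)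
  have hGR : ∀ i j, i ≤ j → |G i j - (Rᵀ * R) i j| ≤ ε * (β i * β j) := by
    intro i j hij
    have h1 : |G i j - ∑ l ∈ Finset.Iic i, R l i * R l j| ≤
        ε * ∑ l ∈ Finset.Iic i, |R l i| * |R l j| := by
      rcases hij.lt_or_eq with hlt | rfl
      · exact h.abs_sub_le_of_lt hu0 hu1 hlt (key i).1.ne'
      · exact (key i).2
    rw [hsum i _ fun l hl => by rw [h.1 l i hl, zero_mul],
      hsum i _ fun l hl => by rw [h.1 l i hl, abs_zero, zero_mul]] at h1
    exact h1.trans (mul_le_mul_of_nonneg_left (sum_abs_mul_abs_le_sqrt _ _ _) hε0)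
  have hβα : ∀ i, β i ≤ Real.sqrt 1.002 * α i := fun i => by
    have h1 := (abs_le.1 (hGR i i le_rfl)).1
    have h2 : (Rᵀ * R) i i = β i ^ 2 := by rw [hβsq]; simp [Matrix.mul_apply, sq]
    have h3 := (abs_le.1 (hG i i le_rfl)).1
    rw [h2] at h1
    rw [hAα] at h3
    refine le_of_sq_le_sq ?_ (mul_nonneg (Real.sqrt_nonneg _) (hα i))
    rw [mul_pow, Real.sq_sqrt (show (0 : ℝ) ≤ 1.002 by norm_num)]
    nlinarith [sq_nonneg (α i), sq_nonneg (β i)]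
  have hle : ∀ i j, i ≤ j → |(Rᵀ * R - A) i j| ≤ (δ + 1.002 * ε) * (α i * α j) := by
    intro i j hij
    have h1 := hGR i j hij
    have h2 := hG i j hij
    have h3 : β i * β j ≤ 1.002 * (α i * α j) := by
      refine (mul_le_mul (hβα i) (hβα j) (hβ0 j)
        (mul_nonneg (Real.sqrt_nonneg _) (hα i))).trans_eq ?_
      rw [mul_mul_mul_comm, Real.mul_self_sqrt (by norm_num)]
    have h4 := mul_le_mul_of_nonneg_left h3 hε0
    rw [abs_sub_comm] at h1 h2
    have h5 := abs_add_le ((Rᵀ * R) i j - G i j) (G i j - A i j)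
    rw [sub_add_sub_cancel] at h5
    rw [Matrix.sub_apply]
    linarith
  intro i j
  rcases le_total i j with hij | hij
  · exact hle i j hij
  · have h1 := hle j i hij
    have hs : (Rᵀ * R - A).IsSymm := by
      rw [Matrix.IsSymm, Matrix.transpose_sub, hA.eq, Matrix.transpose_mul,
        Matrix.transpose_transpose]
    rwa [hs.apply, mul_comm (α j)] at h1

end Cholesky

/-! ### CholeskyQR of a well-conditioned matrix -/

section CholQR

variable {m k : ℕ} {u : ℝ}

theorem sum_sq_mulVec_eq (X : Matrix (Fin m) (Fin k) ℝ) (v : Fin k → ℝ) :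
    ∑ i, (X *ᵥ v) i ^ 2 = v ⬝ᵥ ((Xᵀ * X) *ᵥ v) := by
  rw [← Matrix.mulVec_mulVec, Matrix.dotProduct_mulVec, Matrix.vecMul_transpose, dotProduct]
  exact Finset.sum_congr rfl fun i _ => sq _

theorem abs_dotProduct_mulVec_le (E : Matrix (Fin k) (Fin k) ℝ) (v : Fin k → ℝ) :
    |v ⬝ᵥ (E *ᵥ v)| ≤ norm2 E * ∑ i, v i ^ 2 := by
  refine le_of_sq_le_sq ?_
    (mul_nonneg (norm2_nonneg E) (Finset.sum_nonneg fun _ _ => sq_nonneg _))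
  rw [sq_abs]
  refine (Finset.sum_mul_sq_le_sq_mul_sq _ _ _).trans ?_
  have := mul_le_mul_of_nonneg_left (sum_sq_mulVec_le E v)
    (Finset.sum_nonneg fun i _ => sq_nonneg (v i) : 0 ≤ ∑ i, v i ^ 2)
  linarith

/-- Transfers the upper and lower bounds on ‖Xv‖ to ‖Rv‖. -/
theorem abs_sum_sq_mulVec_sub_le (X : Matrix (Fin m) (Fin k) ℝ) (R : Matrix (Fin k) (Fin k) ℝ)
    (v : Fin k → ℝ) :
    |∑ i, (R *ᵥ v) i ^ 2 - ∑ i, (X *ᵥ v) i ^ 2| ≤ norm2 (Rᵀ * R - Xᵀ * X) * ∑ i, v i ^ 2 := by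
  rw [sum_sq_mulVec_eq, sum_sq_mulVec_eq, ← dotProduct_sub, ← Matrix.sub_mulVec]
  exact abs_dotProduct_mulVec_le _ v

/-- Backward error of the computed Cholesky factor of the computed Gram matrix. -/
theorem gram_cholesky_error (hu0 : 0 ≤ u) {X : Matrix (Fin m) (Fin k) ℝ}
    {G R : Matrix (Fin k) (Fin k) ℝ} (hG : ComputedMul u Xᵀ X G) (hR : ComputedCholesky u G R)
    {σ w : ℝ} (hσ : 0 < σ) (hσX : ∀ v : Fin k → ℝ, σ ^ 2 * ∑ j, v j ^ 2 ≤ ∑ i, (X *ᵥ v) i ^ 2)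
    (hX : norm2 X ≤ 6 * σ) (hw : w ≤ 0.00022) (hk : 1 ≤ k) (hmu : m * u ≤ w)
    (hmk : k * (m * u) ≤ w) (hkk : k * (k * u) ≤ w) :
    (∀ j, 0 < R j j) ∧ normF (Rᵀ * R - Xᵀ * X) ≤ 108.3 * w * σ ^ 2 := by
  have hk1 : (1 : ℝ) ≤ k := by exact_mod_cast hk
  have hku0 : 0 ≤ k * u := by positivity
  have hku : k * u ≤ w := by nlinarith
  have huw : u ≤ k * u := by nlinarith
  have hu1 : u < 1 := by linarith
  have hq := one_le_inv_one_sub hu0 hu1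
  have hδ := inv_one_sub_pow_sub_one_le hu0 (n := m) (by linarith)
  have hε := inv_one_sub_pow_sub_one_le hu0 (n := k + 1) (by push_cast; linarith)
  have hδ0 : 0 ≤ (1 - u)⁻¹ ^ m - 1 := sub_nonneg.2 (one_le_pow₀ hq)
  have hε0 : 0 ≤ (1 - u)⁻¹ ^ (k + 1) - 1 := sub_nonneg.2 (one_le_pow₀ hq)
  push_cast at hε
  set α : Fin k → ℝ := fun i => Real.sqrt (∑ l, X l i ^ 2) with hα
  have hα0 : ∀ i, 0 ≤ α i := fun i => Real.sqrt_nonneg _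
  have hαsq : ∀ i, α i ^ 2 = ∑ l, X l i ^ 2 := fun i =>
    Real.sq_sqrt (Finset.sum_nonneg fun _ _ => sq_nonneg _)
  have hΦ : ∑ i, α i ^ 2 ≤ 36 * k * σ ^ 2 := by
    simp_rw [hαsq]
    rw [Finset.sum_comm, ← normF_sq]
    have h1 := (normF_le_sqrt_mul_norm2 X).trans
      (mul_le_mul_of_nonneg_left hX (Real.sqrt_nonneg _))
    have h2 := pow_le_pow_left₀ (normF_nonneg X) h1 2
    rw [mul_pow, Real.sq_sqrt (by positivity)] at h2
    linarith
  have hΦ0 : 0 ≤ ∑ i, α i ^ 2 := Finset.sum_nonneg fun _ _ => sq_nonneg _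
  set ε := (1 - u)⁻¹ ^ (k + 1) - 1
  set δ := (1 - u)⁻¹ ^ m - 1
  have hkδ : k * δ ≤ 1.001 * w := by nlinarith
  -- k (k + 1) u ≤ 2 w, since both k² u and k u are at most w.
  have hkε : k * ε ≤ 2.002 * w := by nlinarith
  have hbound : ∀ c : ℝ, 0 ≤ c → (δ + c * ε) * ∑ i, α i ^ 2 ≤
      36 * (1.001 + c * 2.002) * w * σ ^ 2 := by
    intro c hc
    refine (mul_le_mul_of_nonneg_left hΦ (by positivity)).trans ?_
    have h1 : k * δ + c * (k * ε) ≤ 1.001 * w + c * (2.002 * w) :=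
      add_le_add hkδ (mul_le_mul_of_nonneg_left hkε hc)
    have h2 := mul_le_mul_of_nonneg_right h1 (sq_nonneg σ)
    linarith
  have hchol := hR.pos_and_abs_sub_le hu0 hu1 (A := Xᵀ * X) (α := α) (lam := σ ^ 2) (δ := δ) hα0
    (by rw [Matrix.IsSymm, Matrix.transpose_mul, Matrix.transpose_transpose])
    (fun i => by rw [hαsq]; simp [Matrix.mul_apply, sq])
    (fun v => by
      refine (hσX v).trans_eq ?_
      rw [sum_sq_mulVec_eq]
      simp only [dotProduct, Matrix.mulVec, Finset.mul_sum]
      exact Finset.sum_congr rfl fun i _ => Finset.sum_congr rfl fun j _ => by ring)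
    hδ0 (by linarith) (by linarith)
    (by
      refine (hbound 2.004 (by norm_num)).trans_lt ?_
      nlinarith [sq_pos_of_pos hσ])
    (fun i j _ => by
      have h1 := (hG i j).abs_sub_le hu0 hu1
      rw [Finset.card_univ, Fintype.card_fin] at h1
      exact h1.trans (mul_le_mul_of_nonneg_left (sum_abs_mul_abs_le_sqrt _ _ _) hδ0))
  refine ⟨hchol.1, ?_⟩
  have h1 := normF_le_of_abs_le_mul (A := Rᵀ * R - Xᵀ * X) (x := α) (y := α)
    (t := δ + 1.002 * ε) (by positivity)
    (by simpa only [abs_of_nonneg (hα0 _)] using hchol.2)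
  rw [Real.mul_self_sqrt hΦ0] at h1
  have hw0 : 0 ≤ w * σ ^ 2 := mul_nonneg (hku0.trans hku) (sq_nonneg σ)
  refine h1.trans ((hbound 1.002 (by norm_num)).trans ?_)
  linarith

/-- Backward error of triangular substitution. -/
theorem ComputedTriSolve.normF_sub_le (hu0 : 0 ≤ u) (hu1 : u < 1) {X Q : Matrix (Fin m) (Fin k) ℝ}
    {R : Matrix (Fin k) (Fin k) ℝ} (h : ComputedTriSolve u X R Q) (htri : ∀ i j, j < i → R i j = 0)
    (hR : ∀ j, 0 < R j j) :
    normF (X - Q * R) ≤ ((1 - u)⁻¹ ^ k - 1) * (normF Q * normF R) := by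
  have hq := one_le_inv_one_sub hu0 hu1
  refine normF_le_of_abs_le (sub_nonneg.2 (one_le_pow₀ hq)) fun i j => ?_
  obtain ⟨s, hs, hd⟩ := h i j
  have h1 := hs.abs_sub_mul_le_of_div hu0 hu1 hd (hR j).ne'
  have hsum : ∀ f : Fin k → ℝ, (∀ l, j < l → f l = 0) →
      ∑ l, f l = ∑ l ∈ Finset.Iio j, f l + f j := fun f hf => by
    rw [← Finset.sum_Iic_eq_sum_Iio_add]
    exact (Finset.sum_subset (Finset.subset_univ _) fun l _ hl => hf l (by simpa using hl)).symm
  rw [Matrix.sub_apply, Matrix.mul_apply, hsum _ fun l hl => by rw [htri l j hl, mul_zero],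
    hsum _ fun l hl => by rw [htri l j hl, abs_zero, mul_zero], ← sub_sub, ← abs_mul (Q i j),
    add_comm (∑ l ∈ Finset.Iio j, |Q i l| * |R l j|)]
  refine h1.trans (mul_le_mul_of_nonneg_right ?_ ?_)
  · refine sub_le_sub_right (pow_le_pow_right₀ hq ?_) 1
    rw [Fin.card_Iio]; omega
  · exact add_nonneg (abs_nonneg _) (Finset.sum_nonneg fun _ _ => by positivity)

/-- Backward error of matrix multiplication. -/
theorem ComputedMul.normF_sub_le {n : ℕ} (hu0 : 0 ≤ u) (hu1 : u < 1) {A : Matrix (Fin m) (Fin k) ℝ}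
    {B : Matrix (Fin k) (Fin n) ℝ} {C : Matrix (Fin m) (Fin n) ℝ} (h : ComputedMul u A B C) :
    normF (C - A * B) ≤ ((1 - u)⁻¹ ^ k - 1) * (normF A * normF B) := by
  refine normF_le_of_abs_le (sub_nonneg.2 (one_le_pow₀ (one_le_inv_one_sub hu0 hu1)))
    fun i j => ?_
  have h1 := (h i j).abs_sub_le hu0 hu1
  rw [Finset.card_univ, Fintype.card_fin] at h1
  rwa [Matrix.sub_apply, abs_sub_comm, Matrix.mul_apply]

/-- Consequences of a small backward error of the Cholesky factor, for the exact quotient. -/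
theorem norm2_bounds_of_gram_error {X : Matrix (Fin m) (Fin k) ℝ} {R : Matrix (Fin k) (Fin k) ℝ}
    {σ w : ℝ} (hσ : 0 < σ) (hσX : ∀ v : Fin k → ℝ, σ ^ 2 * ∑ j, v j ^ 2 ≤ ∑ i, (X *ᵥ v) i ^ 2)
    (hX : norm2 X ≤ 6 * σ) (hw0 : 0 ≤ w) (hw : w ≤ 0.00022) (hdet : IsUnit R.det)
    (hE : norm2 (Rᵀ * R - Xᵀ * X) ≤ 108.3 * w * σ ^ 2) :
    norm2 R ≤ 6.003 * σ ∧ σ * norm2 R⁻¹ ≤ 1.0123 ∧ norm2 (X * R⁻¹) ≤ 1.0123 ∧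
      norm2 ((X * R⁻¹)ᵀ * (X * R⁻¹) - 1) ≤ 111 * w := by
  have hσ2 : 0 < σ ^ 2 := by positivity
  -- 108.3 · 0.00022 < 0.0239. Below, 0.9761 = 1 - 0.0239 and 1.0123 exceeds 1 / √0.9761.
  have hE' : norm2 (Rᵀ * R - Xᵀ * X) ≤ 0.0239 * σ ^ 2 := by nlinarith
  have hdiff : ∀ v : Fin k → ℝ,
      |∑ i, (R *ᵥ v) i ^ 2 - ∑ i, (X *ᵥ v) i ^ 2| ≤ 0.0239 * σ ^ 2 * ∑ i, v i ^ 2 := fun v =>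
    (abs_sum_sq_mulVec_sub_le X R v).trans (mul_le_mul_of_nonneg_right hE'
      (Finset.sum_nonneg fun _ _ => sq_nonneg _))
  have hRR : R * R⁻¹ = 1 := Matrix.mul_nonsing_inv R hdet
  have hRv : ∀ v : Fin k → ℝ, R *ᵥ (R⁻¹ *ᵥ v) = v := fun v => by
    rw [Matrix.mulVec_mulVec, hRR, Matrix.one_mulVec]
  have hinv : ∀ v : Fin k → ℝ, 0.9761 * σ ^ 2 * ∑ i, (R⁻¹ *ᵥ v) i ^ 2 ≤ ∑ i, v i ^ 2 := fun v => by
    have h1 := (abs_le.1 (hdiff (R⁻¹ *ᵥ v))).1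
    have h2 := hσX (R⁻¹ *ᵥ v)
    rw [hRv] at h1
    linarith
  have hnR : norm2 R ≤ 6.003 * σ := by
    refine norm2_le_of_sum_sq (by positivity) fun v => ?_
    have h1 := (abs_le.1 (hdiff v)).2
    have h2 := sum_sq_mulVec_le X v
    have hv : 0 ≤ ∑ i, v i ^ 2 := Finset.sum_nonneg fun _ _ => sq_nonneg _
    have h3 := mul_le_mul_of_nonneg_right (pow_le_pow_left₀ (norm2_nonneg X) hX 2) hv
    have h4 : 0 ≤ σ ^ 2 * ∑ i, v i ^ 2 := by positivity
    nlinarith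
  have hnI : norm2 R⁻¹ ≤ 1.0123 / σ := by
    refine norm2_le_of_sum_sq (by positivity) fun v => ?_
    have h1 := hinv v
    have hv : 0 ≤ ∑ i, v i ^ 2 := Finset.sum_nonneg fun _ _ => sq_nonneg _
    rw [div_pow, div_mul_eq_mul_div, le_div_iff₀ hσ2]
    linarith
  have hσI : σ * norm2 R⁻¹ ≤ 1.0123 := by
    rw [le_div_iff₀ hσ] at hnI
    linarith
  have hnY : norm2 (X * R⁻¹) ≤ 1.0123 := by
    refine norm2_le_of_sum_sq (by norm_num) fun v => ?_
    rw [← Matrix.mulVec_mulVec]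
    have h1 := (abs_le.1 (hdiff (R⁻¹ *ᵥ v))).1
    have h2 := hinv v
    rw [hRv] at h1
    have hv : 0 ≤ ∑ i, v i ^ 2 := Finset.sum_nonneg fun _ _ => sq_nonneg _
    linarith
  refine ⟨hnR, hσI, hnY, ?_⟩
  have e : (X * R⁻¹)ᵀ * (X * R⁻¹) - 1 = -((R⁻¹)ᵀ * (Rᵀ * R - Xᵀ * X) * R⁻¹) := by
    have h1 : (R⁻¹)ᵀ * Rᵀ = 1 := by rw [← Matrix.transpose_mul, hRR, Matrix.transpose_one]
    rw [Matrix.transpose_mul, Matrix.mul_sub, Matrix.sub_mul, ← Matrix.mul_assoc (R⁻¹)ᵀ Rᵀ R, h1,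
      Matrix.one_mul, hRR, neg_sub]
    simp only [Matrix.mul_assoc]
  rw [e, norm2_neg]
  have h1 := norm2_mul_le ((R⁻¹)ᵀ * (Rᵀ * R - Xᵀ * X)) R⁻¹
  have h2 := norm2_mul_le (R⁻¹)ᵀ (Rᵀ * R - Xᵀ * X)
  rw [norm2_transpose] at h2
  have hn := norm2_nonneg R⁻¹
  calc _ ≤ norm2 R⁻¹ * (108.3 * w * σ ^ 2) * norm2 R⁻¹ :=
        h1.trans (mul_le_mul_of_nonneg_right (h2.trans (mul_le_mul_of_nonneg_left hE hn)) hn)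
    _ = 108.3 * w * (σ * norm2 R⁻¹) ^ 2 := by ring
    _ ≤ 108.3 * w * 1.0123 ^ 2 :=
        mul_le_mul_of_nonneg_left (pow_le_pow_left₀ (by positivity) hσI 2) (by positivity)
    _ ≤ 111 * w := by linarith

/-- Expand QᵀQ with Q = Y - (Y - Q). -/
theorem norm2_transpose_mul_self_sub_one_le {Q Y : Matrix (Fin m) (Fin k) ℝ} :
    norm2 (Qᵀ * Q - 1) ≤ norm2 (Yᵀ * Y - 1) + 2 * (norm2 Y * norm2 (Y - Q)) +
      norm2 (Y - Q) * norm2 (Y - Q) := by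
  have e : Qᵀ * Q - 1 = (Yᵀ * Y - 1) - (Yᵀ * (Y - Q) + (Y - Q)ᵀ * Y) + (Y - Q)ᵀ * (Y - Q) := by
    rw [Matrix.transpose_sub]
    simp only [Matrix.mul_sub, Matrix.sub_mul]
    abel
  rw [e]
  have h1 := norm2_mul_le Yᵀ (Y - Q)
  have h2 := norm2_mul_le (Y - Q)ᵀ Y
  have h3 := norm2_mul_le (Y - Q)ᵀ (Y - Q)
  rw [norm2_transpose] at h1 h2 h3
  have h4 := norm2_add_le (Yᵀ * (Y - Q)) ((Y - Q)ᵀ * Y)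
  have h5 := norm2_sub_le (Yᵀ * Y - 1) (Yᵀ * (Y - Q) + (Y - Q)ᵀ * Y)
  have h6 := norm2_add_le ((Yᵀ * Y - 1) - (Yᵀ * (Y - Q) + (Y - Q)ᵀ * Y)) ((Y - Q)ᵀ * (Y - Q))
  linarith

/-- Stability of CholeskyQR for a matrix of condition number at most `6`. -/
theorem ComputedCholQR.bounds (hu0 : 0 ≤ u) {X Q : Matrix (Fin m) (Fin k) ℝ}
    {R : Matrix (Fin k) (Fin k) ℝ} (h : ComputedCholQR u X Q R) {σ w : ℝ} (hσ : 0 < σ)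
    (hσX : ∀ v : Fin k → ℝ, σ ^ 2 * ∑ j, v j ^ 2 ≤ ∑ i, (X *ᵥ v) i ^ 2)
    (hX : norm2 X ≤ 6 * σ) (hw : w ≤ 0.00022) (hk : 1 ≤ k) (hmu : m * u ≤ w)
    (hmk : k * (m * u) ≤ w) (hkk : k * (k * u) ≤ w) :
    norm2 Q ≤ 1.014 ∧ normF R ≤ Real.sqrt k * (6.003 * σ) ∧
      normF (X - Q * R) ≤ 6.1 * (k * (k * u)) * σ ∧ norm2 (Qᵀ * Q - 1) ≤ 180 * w := by
  obtain ⟨G, hG, hR, hQ⟩ := h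
  obtain ⟨hpos, hE⟩ := gram_cholesky_error hu0 hG hR hσ hσX hX hw hk hmu hmk hkk
  have hk1 : (1 : ℝ) ≤ k := by exact_mod_cast hk
  have hku0 : 0 ≤ k * u := by positivity
  have hkku : k * u ≤ k * (k * u) := by nlinarith
  have hw0 : 0 ≤ w := by linarith
  have huw : u ≤ k * u := by nlinarith
  have hu1 : u < 1 := by linarith
  have hφ := inv_one_sub_pow_sub_one_le hu0 (n := k) (by linarith)
  have hφ0 : 0 ≤ (1 - u)⁻¹ ^ k - 1 := sub_nonneg.2 (one_le_pow₀ (one_le_inv_one_sub hu0 hu1))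
  have hdet : IsUnit R.det := by
    rw [Matrix.det_of_isUpperTriangular fun i j hij => hR.1 i j hij, isUnit_iff_ne_zero]
    exact Finset.prod_ne_zero_iff.2 fun i _ => (hpos i).ne'
  obtain ⟨hnR, hnI, hnY, hYY⟩ := norm2_bounds_of_gram_error hσ hσX hX hw0 hw hdet
    ((norm2_le_normF _).trans hE)
  have hF := hQ.normF_sub_le hu0 hu1 hR.1 hpos
  have hRF := (normF_le_sqrt_mul_norm2 R).trans
    (mul_le_mul_of_nonneg_left hnR (Real.sqrt_nonneg _))
  have hYF := (normF_le_sqrt_mul_norm2 (X * R⁻¹)).trans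
    (mul_le_mul_of_nonneg_left hnY (Real.sqrt_nonneg _))
  have e : X * R⁻¹ - Q = (X - Q * R) * R⁻¹ := by
    rw [Matrix.sub_mul, Matrix.mul_nonsing_inv_cancel_right _ _ hdet]
  have hZ : normF (X * R⁻¹ - Q) ≤ normF (X - Q * R) * norm2 R⁻¹ := by
    rw [e]; exact normF_mul_le_right _ _
  set Y := X * R⁻¹
  set φ := (1 - u)⁻¹ ^ k - 1
  set t := Real.sqrt k
  have ht0 : 0 ≤ t := Real.sqrt_nonneg _
  have ht2 : t * t = k := Real.mul_self_sqrt (by positivity)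
  have ht1 : t ≤ k := by nlinarith
  have hQ0 := normF_nonneg Q
  have hF1 : normF (X - Q * R) ≤ φ * t * normF Q * (6.003 * σ) := by
    have := mul_le_mul_of_nonneg_left (mul_le_mul_of_nonneg_left hRF hQ0) hφ0
    linarith
  have hZ1 : normF (Y - Q) ≤ 6.08 * (φ * t * normF Q) := by
    have h1 := mul_le_mul_of_nonneg_right hF1 (norm2_nonneg R⁻¹)
    have h2 : 0 ≤ φ * t * normF Q := by positivity
    have h3 := mul_le_mul_of_nonneg_left hnI h2
    linarith
  have hφt : φ * t ≤ 1.001 * (k * (k * u)) := by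
    have h1 := mul_le_mul_of_nonneg_left ht1 hφ0
    have h2 := mul_le_mul_of_nonneg_right hφ (by positivity : (0 : ℝ) ≤ k)
    linarith
  -- The bound on Y - Q contains ‖Q‖_F itself; its coefficient is about 0.0013, so it is absorbed on
  -- the left.
  have hQF : normF Q ≤ 1.0141 * t := by
    have h1 := normF_sub_le Y (Y - Q)
    rw [sub_sub_cancel] at h1
    have h2 := mul_le_mul_of_nonneg_right hφt hQ0
    have h3 := mul_le_mul_of_nonneg_right (hkk.trans hw) hQ0
    linarith
  have hφk : φ * t * normF Q ≤ 1.0152 * (k * (k * u)) := by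
    have h1 := mul_le_mul_of_nonneg_left hQF (mul_nonneg hφ0 ht0)
    have h2 := mul_le_mul_of_nonneg_right hφ (by positivity : (0 : ℝ) ≤ k)
    have h3 : φ * t * (1.0141 * t) = 1.0141 * (φ * k) := by rw [← ht2]; ring
    have h4 : 0 ≤ k * (k * u) := by positivity
    linarith
  have hZ2 : norm2 (Y - Q) ≤ 6.2 * w := by
    have := norm2_le_normF (Y - Q)
    linarith
  refine ⟨?_, hRF, ?_, ?_⟩
  · have h1 := norm2_sub_le Y (Y - Q)
    rw [sub_sub_cancel] at h1
    linarith
  · have := mul_le_mul_of_nonneg_right hφk (by positivity : 0 ≤ 6.003 * σ)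
    have h4 : 0 ≤ k * (k * u) * σ := by positivity
    linarith
  · have h1 := norm2_transpose_mul_self_sub_one_le (Q := Q) (Y := Y)
    have hZ0 := norm2_nonneg (Y - Q)
    have h2 := mul_le_mul hnY hZ2 hZ0 (by norm_num)
    have h3 := mul_le_mul hZ2 hZ2 hZ0 (by positivity)
    nlinarith

end CholQR

/-! ### Undoing the preconditioning and the final bounds -/

theorem mainTheorem8 {m n p k : ℕ} (hnm : n ≤ m) (hkn : k ≤ n) (hkp : k ≤ p)
    (M : Matrix (Fin m) (Fin n) ℝ) (J : Equiv.Perm (Fin n))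
    (Rsk : Matrix (Fin p) (Fin n) ℝ) (hRsk : IsUpperTri Rsk)
    (u : ℝ) (hu0 : 0 ≤ u) (hu : u ≤ 0.00022 * (m : ℝ)⁻¹ * (n : ℝ)⁻¹)
    (Mpre Q : Matrix (Fin m) (Fin k) ℝ) (Rpre : Matrix (Fin k) (Fin k) ℝ)
    (R : Matrix (Fin k) (Fin n) ℝ)
    (hrun : ComputedPrecondCholQR u hkp hkn M J Rsk Mpre Q Rpre R)
    (hpre : norm2 (pivotCols M J - Mpre * leadingRows hkp Rsk) ≤ 0.01 * norm2 M)
    (hcond : condNumber Mpre ≤ 6) :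
    normF (pivotCols M J - Q * R) ≤
        normF (pivotCols M J - Mpre * leadingRows hkp Rsk) + 60 * (n : ℝ) ^ 2 * u * norm2 M ∧
      norm2 (Q.transpose * Q - 1) ≤ 180 * (m : ℝ) * (n : ℝ) * u := by
  have hcond' : condNumber Mpre ≤ (6 : NNReal) := hcond
  have hσ := sigmaMin_pos_of_condNumber_le hcond'
  have hX : norm2 Mpre ≤ 6 * sigmaMin Mpre := norm2_le_of_condNumber_le hcond'
  have hσX := sigmaMin_sq_mul_le Mpre
  have hk : 1 ≤ k := by
    rcases k.eq_zero_or_pos with rfl | hk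
    · rw [sigmaMin_of_isEmpty] at hσ
      exact absurd hσ (lt_irrefl _)
    · exact hk
  have hk1 : (1 : ℝ) ≤ k := by exact_mod_cast hk
  have hkn' : (k : ℝ) ≤ n := by exact_mod_cast hkn
  have hnm' : (n : ℝ) ≤ m := by exact_mod_cast hnm
  have hn1 : (1 : ℝ) ≤ n := hk1.trans hkn'
  have hm1 : (1 : ℝ) ≤ m := hn1.trans hnm'
  have hw : n * (m * u) ≤ 0.00022 := by
    rw [mul_assoc, ← mul_inv, ← div_eq_mul_inv, le_div_iff₀ (by positivity)] at hu
    linarith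
  have hmu0 : 0 ≤ m * u := by positivity
  have hmk : k * (m * u) ≤ n * (m * u) := mul_le_mul_of_nonneg_right hkn' hmu0
  have hmu : m * u ≤ n * (m * u) := le_mul_of_one_le_left hmu0 hn1
  have hkk : k * (k * u) ≤ n * (m * u) :=
    mul_le_mul hkn' (mul_le_mul_of_nonneg_right (hkn'.trans hnm') hu0) (by positivity)
      (by positivity)
  have hkn2 : k * (k * u) ≤ n ^ 2 * u := by
    rw [sq, mul_assoc]
    exact mul_le_mul hkn' (mul_le_mul_of_nonneg_right hkn' hu0) (by positivity) (by positivity)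
  obtain ⟨hQ, hRF, hF, horth⟩ :=
    hrun.decompose.bounds hu0 hσ hσX hX hw hk hmu hmk hkk
  refine ⟨?_, horth.trans_eq (by ring)⟩
  have hku : k * u ≤ k * (k * u) := le_mul_of_one_le_left (by positivity) hk1
  have huk : u ≤ k * u := le_mul_of_one_le_left hu0 hk1
  have hu1 : u < 1 := by linarith
  have hφ := inv_one_sub_pow_sub_one_le hu0 (n := k) (by linarith)
  have hφ0 : 0 ≤ (1 - u)⁻¹ ^ k - 1 := sub_nonneg.2 (one_le_pow₀ (one_le_inv_one_sub hu0 hu1))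
  have hH := hrun.undo.normF_sub_le hu0 hu1
  set S := leadingRows hkp Rsk
  set Mn := pivotCols M J
  set σ := sigmaMin Mpre
  set φ := (1 - u)⁻¹ ^ k - 1
  set t := Real.sqrt k
  have hM0 := norm2_nonneg M
  have ht0 : 0 ≤ t := Real.sqrt_nonneg _
  have ht2 : t * t = k := Real.mul_self_sqrt (by positivity)
  have hXS : norm2 (Mpre * S) ≤ 1.01 * norm2 M := by
    have h1 := norm2_sub_le Mn (Mn - Mpre * S)
    rw [sub_sub_cancel] at h1
    have h2 : norm2 Mn ≤ norm2 M := norm2_pivotCols M J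
    linarith
  -- σ ‖Sv‖ ≤ ‖X S v‖ bounds S with no reference to its own conditioning.
  have hS : norm2 S ≤ 1.01 * norm2 M / σ := by
    refine norm2_le_of_sum_sq (by positivity) fun v => ?_
    have h1 := hσX (S *ᵥ v)
    rw [Matrix.mulVec_mulVec] at h1
    have h2 := sum_sq_mulVec_le (Mpre * S) v
    have h3 := mul_le_mul_of_nonneg_right (pow_le_pow_left₀ (norm2_nonneg _) hXS 2)
      (Finset.sum_nonneg fun i _ => sq_nonneg (v i) : 0 ≤ ∑ i, v i ^ 2)
    rw [div_pow, div_mul_eq_mul_div, le_div_iff₀ (by positivity)]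
    linarith
  have hσS : σ * norm2 S ≤ 1.01 * norm2 M := by
    rw [le_div_iff₀ hσ] at hS
    linarith
  -- Counting the k rows of S instead of its n columns gives √k, so that the product with ‖Rpre‖_F
  -- costs only k.
  have hSF := normF_le_sqrt_mul_norm2' S
  have hFS : normF ((Mpre - Q * Rpre) * S) ≤ 6.2 * (k * (k * u)) * norm2 M := by
    have h1 := normF_mul_le_right (Mpre - Q * Rpre) S
    have h2 := mul_le_mul_of_nonneg_right hF (norm2_nonneg S)
    have h3 := mul_le_mul_of_nonneg_left hσS (by positivity : 0 ≤ 6.1 * (k * (k * u)))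
    have h4 : 0 ≤ k * (k * u) * norm2 M := by positivity
    linarith
  have hHF : normF (R - Rpre * S) ≤ 6.1 * (k * (k * u)) * norm2 M := by
    have h1 : normF Rpre * normF S ≤ (t * (6.003 * σ)) * (t * norm2 S) :=
      mul_le_mul hRF hSF (normF_nonneg S) (by positivity)
    have h2 : (t * (6.003 * σ)) * (t * norm2 S) = 6.003 * k * (σ * norm2 S) := by
      rw [← ht2]; ring
    have h3 := mul_le_mul_of_nonneg_left hσS (by positivity : (0 : ℝ) ≤ 6.003 * k)
    have h4 := mul_le_mul_of_nonneg_left (h1.trans (h2.trans_le h3)) hφ0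
    have h5 := mul_le_mul_of_nonneg_right hφ
      (by positivity : 0 ≤ 6.003 * k * (1.01 * norm2 M))
    have h6 : 0 ≤ k * (k * u) * norm2 M := by positivity
    linarith
  have hQH : normF (Q * (R - Rpre * S)) ≤ 1.014 * (6.1 * (k * (k * u)) * norm2 M) :=
    (normF_mul_le_left _ _).trans (mul_le_mul hQ hHF (normF_nonneg _) (by norm_num))
  -- The given residual, the CholeskyQR error carried through S, and the error of the last product
  -- carried through Q; the last two add up to about 12.4 k² u ‖M‖₂.
  have e : Mn - Q * R = (Mn - Mpre * S) + ((Mpre - Q * Rpre) * S - Q * (R - Rpre * S)) := by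
    rw [Matrix.sub_mul, Matrix.mul_sub, Matrix.mul_assoc Q Rpre S]
    abel
  have h1 := normF_add_le (Mn - Mpre * S) ((Mpre - Q * Rpre) * S - Q * (R - Rpre * S))
  have h2 := normF_sub_le ((Mpre - Q * Rpre) * S) (Q * (R - Rpre * S))
  have h3 := mul_le_mul_of_nonneg_right hkn2 hM0
  have h4 : 0 ≤ (n : ℝ) ^ 2 * u * norm2 M := by positivity
  rw [e]
  linarith
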